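/- Let $d\ge 2$ be an integer, $1<p<\infty$, $\alpha^*=\frac{p-d}{p-1}$, and let $\zeta\in\{0,\infty\}$. Write $B_r=\{x\in\mathbb R^d:|x|<r\}$, $S_r=\{|x|=r\}$, $B_r^*=\{|x|>r\}$, and call $B_\rho\setminus\{0\}$ (if $\zeta=0$), respectively $B_\rho^*$ (if $\zeta=\infty$), with $\rho>0$, the punctured neighborhoods of $\zeta$. Let $V\in L^\infty_{\mathrm{loc}}$ be a real function on a punctured neighborhood of $\zeta$. Put $a=0$ if $\zeta=0$ and $p\le d$; $a=1$ if $\zeta=0$ and $p>d$; $a=\infty$ if $\zeta=\infty$ and $p\ge d$; $a=1$ if $\zeta=\infty$ and $p<d$. Assume that $V$ satisfies Condition (C1) near $\zeta$: there is a positive bounded continuous function $g:(0,\infty)\to(0,\infty)$ such that $|V(x)|\le G(|x|):=g(|x|)\,|x|^{-p}$ for almost every $x$ in some punctured neighborhood of $\zeta$ and $$\left|\int_\zeta^1 t^{\alpha^*}\left|\int_a^t \frac{g(s)}{s^p}\,s^{d-1}\,ds\right|^{\frac1{p-1}}\frac{dt}{t}\right|<\infty .$$ Let $$\tilde W(r)=\frac1{|B_1|}\left|\int_\zeta^{r}t^{\alpha^*}\left(\int_{X_t}G(|y|)\,dy\right)^{\frac1{p-1}}\frac{dt}{t}\right|$$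 be the Wolff potential of $G$ around $\zeta$, where $X_t=B_t$ if $\zeta=0$, $p\le d$; $X_t=B_1\setminus B_t$ if $\zeta=0$, $p>d$; $X_t=B_t^*$ if $\zeta=\infty$, $p\ge d$; $X_t=B_t\setminus B_1$ if $\zeta=\infty$, $p<d$. A function $u\in C^1(U)$ on an open set $U$ is a subsolution (respectively, supersolution) of $-\operatorname{div}(|\nabla u|^{p-2}\nabla u)+V|u|^{p-2}u=0$ in $U$ if $\int_U(|\nabla u|^{p-2}\nabla u\cdot\nabla\varphi+V|u|^{p-2}u\varphi)\,dx\le0$ (respectively, $\ge0$) for every nonnegative $\varphi\in C_c^\infty(U)$. For a function $u$ put $M(r)=\sup_{S_r}u$ and $m(r)=\inf_{S_r}u$. (1) Let $u$ be a positive subsolution in a punctured neighborhood of $\zeta$ such that $\lim_{x\to\zeta}u(x)=0$ if $\zeta=0,\ p>d$ or $\zeta=\infty,\ p<d$, and $\lim_{x\to\zeta}u(x)=\infty$ if $\zeta=0,\ p\le d$ or $\zeta=\infty,\ p\ge d$. If $\zeta=0$ (respectively, $\zeta=\infty$), there is $R_2>0$ such that for every $0<r_2<R_2$ (respectively, $r_2>R_2$)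 there is $0<R_1<r_2$ (respectively, $R_1>r_2$) such that for every $0<r_1<R_1$ (respectively, $r_1>R_1$) we have $\tilde W(r_1)<\tilde W(r_2)$ and $$M(r_3)\le M(r_1)\,\frac{\tilde W(r_2)-\tilde W(r_3)}{\tilde W(r_2)-\tilde W(r_1)}+M(r_2)\,\frac{\tilde W(r_3)-\tilde W(r_1)}{\tilde W(r_2)-\tilde W(r_1)}$$ for all $r_3\in(r_1,r_2)$ (respectively, $r_3\in(r_2,r_1)$). Moreover, $M$ is a monotone (nondecreasing or nonincreasing) function of $r$ near $\zeta$. (2) Let $u$ be a positive supersolution in a punctured neighborhood of $\zeta$ such that $\lim_{x\to\zeta}u(x)=\infty$ if $\zeta=0,\ p>d$ or $\zeta=\infty,\ p<d$, and $\lim_{x\to\zeta}u(x)=0$ if $\zeta=0,\ p\le d$ or $\zeta=\infty,\ p\ge d$. If $\zeta=0$ (respectively, $\zeta=\infty$), there is $R_2>0$ such that for every $0<r_2<R_2$ (respectively, $r_2>R_2$) there is $0<R_1<r_2$ (respectively, $R_1>r_2$) such that for every $0<r_1<R_1$ (respectively, $r_1>R_1$) we have $\tilde W(r_1)<\tilde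 W(r_2)$ and $$m(r_1)\,\frac{\tilde W(r_2)-\tilde W(r_3)}{\tilde W(r_2)-\tilde W(r_1)}+m(r_2)\,\frac{\tilde W(r_3)-\tilde W(r_1)}{\tilde W(r_2)-\tilde W(r_1)}\le m(r_3)$$ for all $r_3\in(r_1,r_2)$ (respectively, $r_3\in(r_2,r_1)$). Moreover, $m$ is a monotone (nondecreasing or nonincreasing) function of $r$ near $\zeta$. -/

import Mathlib

open MeasureTheory Filter Topology Set
open scoped ContDiff

noncomputable section

namespace ThreeSpheres

/-- The isolated singular point `ζ`: the origin or the point at infinity. -/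
inductive SingularPoint where
  | zero : SingularPoint
  | infty : SingularPoint

/-- `ℝ^d` with the Euclidean norm. -/
abbrev E (d : ℕ) : Type := EuclideanSpace ℝ (Fin d)

/-- The standard punctured neighbourhoods of `ζ`: `B_ρ \ {0}` for `ζ = 0`, and the exterior
domain `{|x| > ρ}` for `ζ = ∞`. -/
def puncturedNhd (d : ℕ) : SingularPoint → ℝ → Set (E d)
  | .zero, ρ => Metric.ball 0 ρ \ {0}
  | .infty, ρ => (Metric.closedBall 0 ρ)ᶜ

/-- The filter `x → ζ` (with `x ≠ ζ`). -/
def nhdsSing (d : ℕ) : SingularPoint → Filter (E d)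
  | .zero => 𝓝[≠] 0
  | .infty => Bornology.cobounded (E d)

/-- `V ∈ L^∞_loc(U)`. -/
def LocBounded {d : ℕ} (V : E d → ℝ) (U : Set (E d)) : Prop :=
  ∀ K : Set (E d), IsCompact K → K ⊆ U → MemLp V ⊤ (volume.restrict K)

/-- Nonnegative test functions `φ ∈ C_c^∞(U)`. -/
structure IsNonnegTest {d : ℕ} (U : Set (E d)) (φ : E d → ℝ) : Prop where
  smooth : ContDiff ℝ ∞ φ
  compactSupport : HasCompactSupport φ
  support_subset : tsupport φ ⊆ U
  nonneg : ∀ x, 0 ≤ φ x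

/-- The weak form of `Q'(v) = -Δ_p v + V |v|^{p-2} v` on `U`, tested against `φ`:
`∫_U (|∇v|^{p-2} ∇v · ∇φ + V |v|^{p-2} v φ) dx`. -/
def weakForm {d : ℕ} (p : ℝ) (V : E d → ℝ) (U : Set (E d)) (v φ : E d → ℝ) : ℝ :=
  ∫ x in U, (‖gradient v x‖ ^ (p - 2) * inner ℝ (gradient v x) (gradient φ x)
    + V x * |v x| ^ (p - 2) * v x * φ x)

/-- `v ∈ C^1(U)` is a subsolution of `Q'(v) = 0` in `U`. -/
def IsSubsolution {d : ℕ} (p : ℝ) (V : E d → ℝ) (U : Set (E d)) (v : E d → ℝ) : Prop :=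
  ContDiffOn ℝ 1 v U ∧ ∀ φ, IsNonnegTest U φ → weakForm p V U v φ ≤ 0

/-- `v ∈ C^1(U)` is a supersolution of `Q'(v) = 0` in `U`. -/
def IsSupersolution {d : ℕ} (p : ℝ) (V : E d → ℝ) (U : Set (E d)) (v : E d → ℝ) : Prop :=
  ContDiffOn ℝ 1 v U ∧ ∀ φ, IsNonnegTest U φ → 0 ≤ weakForm p V U v φ

/-- `α* = (p - d) / (p - 1)`. -/
def alphaStar (d : ℕ) (p : ℝ) : ℝ := (p - d) / (p - 1)

/-- `G(s) = g(s) / s^p`. -/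
def radialG (p : ℝ) (g : ℝ → ℝ) (s : ℝ) : ℝ := g s / s ^ p

/-- The open interval between `ζ` and `r`. -/
def intervalTo : SingularPoint → ℝ → Set ℝ
  | .zero, r => Ioo 0 r
  | .infty, r => Ioi r

/-- For `t` between `ζ` and `1`: the open interval between `a` and `t`, where `a = ζ` in the
classical cases (`ζ = 0`, `p ≤ d` or `ζ = ∞`, `p ≥ d`) and `a = 1` in the nonclassical cases. -/
def innerInterval (d : ℕ) (p : ℝ) : SingularPoint → ℝ → Set ℝ
  | .zero, t => if p ≤ d then Ioo 0 t else Ioo t 1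
  | .infty, t => if (d : ℝ) ≤ p then Ioi t else Ioo 1 t

/-- Condition (C1) for `g`: the integral
`|∫_ζ^1 t^{α*} |∫_a^t g(s) s^{-p} s^{d-1} ds|^{1/(p-1)} dt/t|` is finite. The integrands are
nonnegative, so finiteness means integrability of the inner and of the outer integrand. -/
structure ConditionC1 (d : ℕ) (p : ℝ) (ζ : SingularPoint) (g : ℝ → ℝ) : Prop where
  inner_integrable : ∀ t ∈ intervalTo ζ 1,
    IntegrableOn (fun s => radialG p g s * s ^ (d - 1)) (innerInterval d p ζ t)
  outer_integrable : IntegrableOn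
    (fun t => t ^ alphaStar d p *
      (∫ s in innerInterval d p ζ t, radialG p g s * s ^ (d - 1)) ^ (1 / (p - 1)) / t)
    (intervalTo ζ 1)

/-- `V` satisfies Condition (C1) near `ζ` with the function `g`: `g` is a positive bounded
continuous function on `(0, ∞)` satisfying (C1), and `|V(x)| ≤ g(|x|) / |x|^p` near `ζ`. -/
structure SatisfiesC1 (d : ℕ) (p : ℝ) (ζ : SingularPoint) (V : E d → ℝ) (g : ℝ → ℝ) : Prop where
  pos : ∀ s, 0 < s → 0 < g s
  bounded : ∃ C : ℝ, ∀ s, 0 < s → g s ≤ C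
  continuous : ContinuousOn g (Ioi 0)
  dominates : ∃ ρ : ℝ, 0 < ρ ∧
    ∀ᵐ x ∂(volume.restrict (puncturedNhd d ζ ρ)), |V x| ≤ radialG p g ‖x‖
  c1 : ConditionC1 d p ζ g

/-- The domain `X_t ⊆ ℝ^d` in the definition of the Wolff potential around `ζ`. -/
def wolffDomain (d : ℕ) (p : ℝ) : SingularPoint → ℝ → Set (E d)
  | .zero, t => if p ≤ d then Metric.ball 0 t else Metric.ball 0 1 \ Metric.ball 0 t
  | .infty, t => if (d : ℝ) ≤ p then (Metric.closedBall 0 t)ᶜ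
      else Metric.ball 0 t \ Metric.ball 0 1

/-- The Wolff potential of `G` around `ζ` as a function of the radius `r = |x|`:
`(1/|B_1|) |∫_ζ^r t^{α*} (∫_{X_t} G(|y|) dy)^{1/(p-1)} dt/t|`. -/
def wolff (d : ℕ) (p : ℝ) (ζ : SingularPoint) (g : ℝ → ℝ) (r : ℝ) : ℝ :=
  1 / (volume (Metric.ball (0 : E d) 1)).toReal *
    ∫ t in intervalTo ζ r, t ^ alphaStar d p *
      (∫ y in wolffDomain d p ζ t, radialG p g ‖y‖) ^ (1 / (p - 1)) / t

/-- `M_u(r) = sup_{S_r} u`. -/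
def sphereSup {d : ℕ} (u : E d → ℝ) (r : ℝ) : ℝ := sSup (u '' Metric.sphere 0 r)

/-- `m_u(r) = inf_{S_r} u`. -/
def sphereInf {d : ℕ} (u : E d → ℝ) (r : ℝ) : ℝ := sInf (u '' Metric.sphere 0 r)

/-- The limit behaviour required of subsolutions. -/
def SubLimit (d : ℕ) (p : ℝ) (u : E d → ℝ) : SingularPoint → Prop
  | .zero => ((d : ℝ) < p → Tendsto u (nhdsSing d .zero) (𝓝 0)) ∧
      (p ≤ d → Tendsto u (nhdsSing d .zero) atTop)
  | .infty => ((d : ℝ) ≤ p → Tendsto u (nhdsSing d .infty) atTop) ∧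
      (p < d → Tendsto u (nhdsSing d .infty) (𝓝 0))

/-- The limit behaviour required of supersolutions. -/
def SuperLimit (d : ℕ) (p : ℝ) (u : E d → ℝ) : SingularPoint → Prop
  | .zero => ((d : ℝ) < p → Tendsto u (nhdsSing d .zero) atTop) ∧
      (p ≤ d → Tendsto u (nhdsSing d .zero) (𝓝 0))
  | .infty => ((d : ℝ) ≤ p → Tendsto u (nhdsSing d .infty) (𝓝 0)) ∧
      (p < d → Tendsto u (nhdsSing d .infty) atTop)

/-- The value at `W(r₃)` of the affine function of `W` that equals `F(r₁)` at `W(r₁)` and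
`F(r₂)` at `W(r₂)`. -/
def interp (F W : ℝ → ℝ) (r₁ r₂ r₃ : ℝ) : ℝ :=
  F r₁ * ((W r₂ - W r₃) / (W r₂ - W r₁)) + F r₂ * ((W r₃ - W r₁) / (W r₂ - W r₁))

/-- The quantifier pattern "there is `R₂` such that for every `r₂` closer to `ζ` than `R₂` there is
`R₁ = R₁(r₂)` closer to `ζ` than `r₂`, such that for every `r₁` closer to `ζ` than `R₁` and every
`r₃` strictly between `r₁` and `r₂`, `P r₁ r₂ r₃` holds". All radii stay inside the punctured
neighbourhood of radius `ρ`. -/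
def ForSpheresNear (ρ : ℝ) (P : ℝ → ℝ → ℝ → Prop) : SingularPoint → Prop
  | .zero => ∃ R₂, 0 < R₂ ∧ R₂ ≤ ρ ∧ ∀ r₂, 0 < r₂ → r₂ < R₂ →
      ∃ R₁, 0 < R₁ ∧ R₁ < r₂ ∧ ∀ r₁, 0 < r₁ → r₁ < R₁ → ∀ r₃ ∈ Ioo r₁ r₂, P r₁ r₂ r₃
  | .infty => ∃ R₂, 0 < R₂ ∧ ρ ≤ R₂ ∧ ∀ r₂, R₂ < r₂ →
      ∃ R₁, r₂ < R₁ ∧ ∀ r₁, R₁ < r₁ → ∀ r₃ ∈ Ioo r₂ r₁, P r₁ r₂ r₃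

/-- `F` is monotone (nondecreasing or nonincreasing) as a function of the radius near `ζ`. -/
def MonotoneNear (ρ : ℝ) (F : ℝ → ℝ) : SingularPoint → Prop
  | .zero => ∃ δ, 0 < δ ∧ δ ≤ ρ ∧ (MonotoneOn F (Ioo 0 δ) ∨ AntitoneOn F (Ioo 0 δ))
  | .infty => ∃ δ, 0 < δ ∧ ρ ≤ δ ∧ (MonotoneOn F (Ioi δ) ∨ AntitoneOn F (Ioi δ))

end ThreeSpheres

end

open ThreeSpheres

namespace ThreeSpheres

/-! The Wolff potential `W` is itself a radial barrier. Its flux `|W'|^{p-2} W' r^{d-1}` is a signed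
constant multiple of the mass of `G` in `X_r`, so differentiating it gives `Δ_p W = θ k G`, with `θ
= 1` in the classical cases and `θ = -1` in the others (`SatisfiesC1.isProfile`). By homogeneity, `φ
= A + B W` satisfies `Δ_p φ = θ |B|^{p-2} B k G`. Condition (C1) says that `W` is finite, hence `W →
0` at `ζ`.

Let `φ` interpolate `M` (or `m`) between `r₁` and `r₂`, so that `B` is a difference quotient with
respect to `W`. The prescribed limit of `u` fixes the sign of `θ B`: negative for subsolutions,
positive for supersolutions. Once `r₁` is close enough to `ζ`, the end values differ by at least
half of the larger one, while the increment of `W` is small; hence `|B|^{p-1} k > (max φ)^{p-1}`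
(`SignedLimit.slope`).

For subsolutions this gives `-Δ_p φ = |B|^{p-1} k G > G φ^{p-1}`, whereas `-Δ_p u ≤ -V u^{p-1} ≤ G
u^{p-1}`; supersolutions are treated with the signs reversed. The weak comparison principle
(`comparison`) then orders `u` and `φ` on the annulus (`IsSubsolution.le_of_boundary`,
`IsSupersolution.le_of_boundary`).

Since `φ` lies between its end values, `M` obeys a maximum principle and `m` a minimum principle in
`r`. Together with the limit at `ζ` this forces monotonicity (`monotoneNear_of_le_max`). -/

/-! ### The vector field of the `p`-Laplacian. -/

/-- The vector field `v ↦ |v|^{p-2} v` of the `p`-Laplacian. -/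
noncomputable def pField {d : ℕ} (p : ℝ) (v : E d) : E d := ‖v‖ ^ (p - 2) • v

theorem pField_zero {d : ℕ} (p : ℝ) : pField p (0 : E d) = 0 := by simp [pField]

theorem norm_pField {d : ℕ} {p : ℝ} (hp : 1 < p) (v : E d) : ‖pField p v‖ = ‖v‖ ^ (p - 1) := by
  rcases eq_or_ne v 0 with rfl | hv
  · rw [pField_zero, norm_zero, Real.zero_rpow (by linarith)]
  · have h : 0 < ‖v‖ := norm_pos_iff.2 hv
    rw [pField, norm_smul, Real.norm_of_nonneg (by positivity)]
    nth_rewrite 2 [← Real.rpow_one ‖v‖]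
    rw [← Real.rpow_add h]
    congr 1; ring

theorem continuous_pField {d : ℕ} {p : ℝ} (hp : 1 < p) : Continuous (pField p : E d → E d) := by
  rw [continuous_iff_continuousAt]
  intro v
  rcases eq_or_ne v 0 with rfl | hv
  · rw [ContinuousAt, pField_zero, tendsto_zero_iff_norm_tendsto_zero]
    simp_rw [norm_pField hp]
    have : Tendsto (fun v : E d => ‖v‖ ^ (p - 1)) (𝓝 0) (𝓝 (‖(0 : E d)‖ ^ (p - 1))) :=
      (continuous_norm.rpow_const fun _ => Or.inr (by linarith)).tendsto _
    rwa [norm_zero, Real.zero_rpow (by linarith)] at this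
  · exact (continuousAt_id.norm.rpow_const (Or.inl (by simpa using hv))).smul continuousAt_id

/-- Cauchy–Schwarz bounds the cross terms and leaves `(|v|^{p-1} - |w|^{p-1}) (|v| - |w|) ≥ 0`.
Strict monotonicity is not needed, because `comparison` takes its strictness from the right-hand
sides. -/
theorem pField_monotone {d : ℕ} {p : ℝ} (hp : 1 < p) (v w : E d) :
    0 ≤ inner ℝ (pField p v - pField p w) (v - w) := by
  have key : ∀ v : E d, inner ℝ (pField p v) v = ‖v‖ ^ (p - 1) * ‖v‖ := by
    intro v
    rcases eq_or_ne v 0 with rfl | hv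
    · simp
    · have h : 0 < ‖v‖ := norm_pos_iff.2 hv
      rw [pField, inner_smul_left, real_inner_self_eq_norm_sq, sq, ← mul_assoc]
      congr 1
      simp only [conj_trivial]
      nth_rewrite 2 [← Real.rpow_one ‖v‖]
      rw [← Real.rpow_add h]
      congr 1; ring
  have hcs : ∀ v w : E d, inner ℝ (pField p v) w ≤ ‖v‖ ^ (p - 1) * ‖w‖ := by
    intro v w
    rw [← norm_pField hp]
    exact real_inner_le_norm _ _
  rw [inner_sub_left, inner_sub_right, inner_sub_right, key, key]
  have h1 := hcs v w
  have h2 := hcs w v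
  have h3 : 0 ≤ (‖v‖ ^ (p - 1) - ‖w‖ ^ (p - 1)) * (‖v‖ - ‖w‖) := by
    rcases le_total ‖v‖ ‖w‖ with h | h
    · exact mul_nonneg_of_nonpos_of_nonpos (sub_nonpos.2 (Real.rpow_le_rpow (norm_nonneg _) h
        (by linarith))) (sub_nonpos.2 h)
    · exact mul_nonneg (sub_nonneg.2 (Real.rpow_le_rpow (norm_nonneg _) h
        (by linarith))) (sub_nonneg.2 h)
  nlinarith

/-! ### Divergence theorem for radial fields. -/

/-- Euler's identity, integrated: `∫ x · ∇k = -d ∫ k` for compactly supported `k`. -/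
theorem integral_fderiv_apply_self {d : ℕ} {k : E d → ℝ} (hk : ContDiff ℝ 1 k)
    (hc : HasCompactSupport k) : ∫ x, fderiv ℝ k x x = -(d * ∫ x, k x) := by
  have hdk : Continuous (fderiv ℝ k) := hk.continuous_fderiv one_ne_zero
  have hcd : HasCompactSupport (fderiv ℝ k) := hc.fderiv ℝ
  let e : Fin d → E d := fun i => EuclideanSpace.single i 1
  let l : Fin d → (E d →L[ℝ] ℝ) := fun i => EuclideanSpace.proj i
  have hexp : ∀ x, fderiv ℝ k x x = ∑ i, l i x * fderiv ℝ k x (e i) := by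
    intro x
    have hx : x = ∑ i, l i x • e i := by
      ext j
      simp [l, e, Finset.sum_apply, Pi.single_apply]
    conv_lhs => rw [hx, map_sum]
    simp [← hx]
  have hint : ∀ i, Integrable fun x => l i x * fderiv ℝ k x (e i) := by
    intro i
    apply Continuous.integrable_of_hasCompactSupport
    · exact (l i).continuous.mul (hdk.clm_apply continuous_const)
    · apply HasCompactSupport.mul_left
      exact hcd.comp_left (g := fun L : E d →L[ℝ] ℝ => L (e i)) rfl
  simp_rw [hexp]
  rw [integral_finsetSum _ fun i _ => hint i]
  -- Integration by parts in the `i`-th coordinate, using `∂ᵢ xᵢ = 1`.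
  have hi : ∀ i, ∫ x, l i x * fderiv ℝ k x (e i) = -∫ x, k x := by
    intro i
    have hone : ∀ x, fderiv ℝ (fun y => l i y) x (e i) = 1 := by
      intro x
      rw [ContinuousLinearMap.fderiv]
      simp [l, e]
    rw [integral_mul_fderiv_eq_neg_fderiv_mul_of_integrable]
    · simp only [hone, one_mul]
    · simp only [hone, one_mul]
      exact hk.continuous.integrable_of_hasCompactSupport hc
    · exact hint i
    · exact ((l i).continuous.mul hk.continuous).integrable_of_hasCompactSupport hc.mul_left
    · exact fun x _ => (l i).differentiableAt
    · exact fun x _ => hk.differentiable one_ne_zero x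
  simp [hi]

theorem contDiffOn_one_of_hasDerivAt {J : Set ℝ} (hJ : IsOpen J) {H h : ℝ → ℝ}
    (hH : ∀ r ∈ J, HasDerivAt H (h r) r) (hh : ContinuousOn h J) : ContDiffOn ℝ 1 H J := by
  rw [contDiffOn_one_iff_derivWithin hJ.uniqueDiffOn]
  refine ⟨fun r hr => (hH r hr).differentiableAt.differentiableWithinAt, ?_⟩
  exact hh.congr fun r hr => by rw [derivWithin_of_isOpen hJ hr, (hH r hr).deriv]

theorem hasFDerivAt_comp_norm {d : ℕ} {H : ℝ → ℝ} {h : ℝ} {x : E d} (hx : x ≠ 0)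
    (hH : HasDerivAt H h ‖x‖) :
    HasFDerivAt (fun y : E d => H ‖y‖) ((h / ‖x‖) • innerSL ℝ x) x := by
  have h1 : HasFDerivAt (fun y : E d => ‖y‖) (fderiv ℝ (fun y : E d => ‖y‖) x) x :=
    (differentiableAt_id.norm ℝ hx).hasFDerivAt
  have h2 := hH.comp_hasFDerivAt x h1
  refine h2.congr_fderiv ?_
  rw [div_eq_mul_inv, mul_smul]
  congr 1
  -- The derivative of the norm is identified by writing it as the square root of the smooth
  -- function `‖y‖²`.
  have h3 : HasFDerivAt (fun y : E d => Real.sqrt (‖y‖ ^ 2))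
      ((1 / (2 * Real.sqrt (‖x‖ ^ 2))) • (2 • (innerSL ℝ x))) x :=
    (hasStrictFDerivAt_norm_sq x).hasFDerivAt.sqrt (by positivity)
  simp only [Real.sqrt_sq (norm_nonneg _)] at h3
  rw [h1.unique h3]
  ext y
  have : ‖x‖ ≠ 0 := norm_ne_zero_iff.2 hx
  simp
  field_simp

theorem contDiffAt_comp_norm {d : ℕ} {J : Set ℝ} (hJ : IsOpen J) {H : ℝ → ℝ}
    (hH : ContDiffOn ℝ 1 H J) {x : E d} (hx : x ≠ 0) (hxJ : ‖x‖ ∈ J) :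
    ContDiffAt ℝ 1 (fun y : E d => H ‖y‖) x :=
  ContDiffAt.comp x (hH.contDiffAt (hJ.mem_nhds hxJ)) (contDiffAt_norm ℝ hx)

/-- The divergence theorem for the radial field `H(|x|) |x|^{-d} x`. -/
theorem integral_radial_field {d : ℕ} {J : Set ℝ} (hJ : IsOpen J) (hJ0 : J ⊆ Ioi 0)
    {H h : ℝ → ℝ} (hH : ∀ r ∈ J, HasDerivAt H (h r) r) (hh : ContinuousOn h J)
    {η : E d → ℝ} (hη : ContDiff ℝ 1 η) (hc : HasCompactSupport η)
    (hs : ∀ x ∈ tsupport η, ‖x‖ ∈ J) :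
    ∫ x, fderiv ℝ η x ((H ‖x‖ / ‖x‖ ^ d) • x) = -∫ x, h ‖x‖ * ‖x‖ / ‖x‖ ^ d * η x := by
  have hH1 := contDiffOn_one_of_hasDerivAt hJ hH hh
  have hne : ∀ x ∈ tsupport η, x ≠ 0 := fun x hx => by
    have := hJ0 (hs x hx)
    exact norm_pos_iff.1 this
  set Q : ℝ → ℝ := fun r => H r / r ^ d with hQ
  have hQd : ∀ r ∈ J, HasDerivAt Q (h r / r ^ d - d * H r / r ^ (d + 1)) r := by
    intro r hr
    have hr0 : r ≠ 0 := (hJ0 hr).ne'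
    refine ((hH r hr).div (hasDerivAt_pow d r) (pow_ne_zero d hr0)).congr_deriv ?_
    rcases d with _ | d
    · simp
    · simp only [Nat.add_sub_cancel]
      field_simp
      ring
  have hQ1 : ContDiffOn ℝ 1 Q J :=
    hH1.div (contDiffOn_id.pow d) fun r hr => pow_ne_zero d (hJ0 hr).ne'
  set k : E d → ℝ := fun x => Q ‖x‖ * η x with hkdef
  have hkc : HasCompactSupport k := hc.mul_left
  have hzero : ∀ x ∉ tsupport η, η =ᶠ[𝓝 x] 0 := fun x hx => notMem_tsupport_iff_eventuallyEq.1 hx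
  have hk : ContDiff ℝ 1 k := by
    rw [contDiff_iff_contDiffAt]
    intro x
    by_cases hx : x ∈ tsupport η
    · exact (contDiffAt_comp_norm hJ hQ1 (hne x hx) (hs x hx)).mul hη.contDiffAt
    · have : k =ᶠ[𝓝 x] fun _ => 0 := by
        filter_upwards [hzero x hx] with y hy
        simp [hkdef, hy]
      exact contDiffAt_const.congr_of_eventuallyEq this
  have hE := integral_fderiv_apply_self hk hkc
  have hcontQ : ∀ {f : ℝ → ℝ}, ContinuousOn f J → Continuous fun x : E d => f ‖x‖ * η x := by
    intro f hf
    rw [continuous_iff_continuousAt]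
    intro x
    by_cases hx : x ∈ tsupport η
    · exact ((hf.continuousAt (hJ.mem_nhds (hs x hx))).comp
        continuous_norm.continuousAt).mul hη.continuous.continuousAt
    · have : (fun x : E d => f ‖x‖ * η x) =ᶠ[𝓝 x] fun _ => 0 := by
        filter_upwards [hzero x hx] with y hy
        simp [hy]
      exact continuousAt_const.congr this.symm
  -- With `k = Q(|x|) η` and `Q = H / r^d`, one has `r Q' = h r / r^d - d Q`. The resulting term `d
  -- k` cancels against Euler's identity for `k` after integration.
  have hpt : ∀ x, fderiv ℝ η x ((H ‖x‖ / ‖x‖ ^ d) • x) =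
      fderiv ℝ k x x - h ‖x‖ * ‖x‖ / ‖x‖ ^ d * η x + d * k x := by
    intro x
    by_cases hx : x ∈ tsupport η
    · have h1 := (hasFDerivAt_comp_norm (hne x hx) (hQd _ (hs x hx))).mul
        (hη.differentiable one_ne_zero x).hasFDerivAt
      have h2 : fderiv ℝ k x = _ := h1.fderiv
      have hx0 : ‖x‖ ≠ 0 := norm_ne_zero_iff.2 (hne x hx)
      rw [h2]
      simp [hkdef, hQ]
      field_simp
      ring
    · have h1 : fderiv ℝ η x = 0 := by
        rw [(hzero x hx).fderiv_eq]; simp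
      have h2 : fderiv ℝ k x = 0 := by
        have : k =ᶠ[𝓝 x] fun _ => 0 := by
          filter_upwards [hzero x hx] with y hy
          simp [hkdef, hy]
        rw [this.fderiv_eq]; simp
      have h3 : η x = 0 := (hzero x hx).eq_of_nhds
      have h4 : k x = 0 := by simp [hkdef, h3]
      simp [h1, h2, h4, h3]
  simp_rw [hpt]
  have hi1 : Integrable fun x => fderiv ℝ k x x :=
    ((hk.continuous_fderiv one_ne_zero).clm_apply continuous_id).integrable_of_hasCompactSupport
      (by
        refine (hkc.fderiv ℝ).mono' fun x hx => subset_closure ?_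
        rw [Function.mem_support] at hx ⊢
        exact fun h => hx (by rw [h]; rfl))
  have hi2 : Integrable fun x : E d => h ‖x‖ * ‖x‖ / ‖x‖ ^ d * η x :=
    (hcontQ (f := fun r => h r * r / r ^ d) ((hh.mul continuousOn_id).div (continuousOn_id.pow d)
      fun r hr => pow_ne_zero d (hJ0 hr).ne')).integrable_of_hasCompactSupport hc.mul_left
  have hi3 : Integrable fun x => (d : ℝ) * k x :=
    (hk.continuous.integrable_of_hasCompactSupport hkc).const_mul _
  rw [integral_add (f := fun x => fderiv ℝ k x x - h ‖x‖ * ‖x‖ / ‖x‖ ^ d * η x)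
    (hi1.sub hi2) hi3, integral_sub hi1 hi2, hE, integral_const_mul]
  ring

/-! ### Enlarging the class of test functions from smooth to `C^1`. -/

open scoped Convolution
open ContinuousLinearMap

/-- A nonnegative compactly supported `C^1` function is a limit of nonnegative smooth functions,
in the `C^1` sense needed for dominated convergence. -/
theorem exists_smooth_approx {d : ℕ} {U : Set (E d)} (hU : IsOpen U) {η : E d → ℝ}
    (hη : ContDiff ℝ 1 η) (hc : HasCompactSupport η) (hs : tsupport η ⊆ U) (h0 : ∀ x, 0 ≤ η x) :
    ∃ (K : Set (E d)) (C : ℝ) (ψ : ℕ → E d → ℝ), IsCompact K ∧ K ⊆ U ∧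
      (∀ n, IsNonnegTest U (ψ n)) ∧ (∀ n, tsupport (ψ n) ⊆ K) ∧
      (∀ n x, |ψ n x| ≤ C) ∧ (∀ n x v, |fderiv ℝ (ψ n) x v| ≤ C * ‖v‖) ∧
      (∀ x, Tendsto (fun n => ψ n x) atTop (𝓝 (η x))) ∧
      (∀ x v, Tendsto (fun n => fderiv ℝ (ψ n) x v) atTop (𝓝 (fderiv ℝ η x v))) := by
  obtain ⟨δ, hδ, hδU⟩ := hc.isCompact.exists_cthickening_subset_open hU hs
  have hdη : Continuous (fderiv ℝ η) := hη.continuous_fderiv one_ne_zero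
  have hcd : HasCompactSupport (fderiv ℝ η) := hc.fderiv ℝ
  obtain ⟨C₀, hC₀⟩ := hη.continuous.bounded_above_of_compact_support hc
  obtain ⟨C₁, hC₁⟩ := hdη.bounded_above_of_compact_support hcd
  let b : ℕ → ContDiffBump (0 : E d) := fun n =>
    ⟨δ / (2 * (n + 1)), δ / (n + 1), by positivity, by
      apply div_lt_div_of_pos_left hδ (by positivity); nlinarith [n.cast_nonneg (α := ℝ)]⟩
  have hb : Tendsto (fun n => (b n).rOut) atTop (𝓝 0) := by
    have := (tendsto_one_div_add_atTop_nhds_zero_nat (𝕜 := ℝ)).const_mul δ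
    simpa [b, div_eq_mul_inv] using this
  have hbδ : ∀ n, (b n).rOut ≤ δ := fun n => div_le_self hδ.le (by simp)
  let ψ : ℕ → E d → ℝ := fun n => (b n).normed volume ⋆[lsmul ℝ ℝ, volume] η
  have hli : ∀ n, LocallyIntegrable ((b n).normed (volume : Measure (E d))) := fun n =>
    (b n).continuous_normed.locallyIntegrable
  -- The convolution differs from `f x` by at most the oscillation `2 C`, and `|f x| ≤ C`; the crude
  -- factor `3` suffices for a uniform bound.
  have hbound : ∀ n (f : E d → ℝ) (C : ℝ), Continuous f → (∀ x, |f x| ≤ C) → ∀ x,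
      |((b n).normed volume ⋆[lsmul ℝ ℝ, volume] f) x| ≤ 3 * C := by
    intro n f C hf hC x
    have h := (b n).dist_normed_convolution_le (μ := volume) (x₀ := x) (ε := 2 * C)
      hf.aestronglyMeasurable (g := f) (by
        intro y _
        rw [Real.dist_eq]
        have h1 := abs_sub (f y) (f x)
        linarith [hC x, hC y])
    rw [Real.dist_eq] at h
    have h2 := abs_add_le (((b n).normed volume ⋆[lsmul ℝ ℝ, volume] f) x - f x) (f x)
    rw [sub_add_cancel] at h2
    linarith [hC x]
  have hfd : ∀ n x v, fderiv ℝ (ψ n) x v =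
      ((b n).normed volume ⋆[lsmul ℝ ℝ, volume] fun y => fderiv ℝ η y v) x := by
    intro n x v
    rw [(hc.hasFDerivAt_convolution_right (lsmul ℝ ℝ) (hli n) hη x).fderiv]
    exact convolution_precompR_apply (lsmul ℝ ℝ) (hli n) hcd hdη x v
  have hsupp : ∀ n, tsupport (ψ n) ⊆ Metric.cthickening δ (tsupport η) := by
    intro n
    refine closure_minimal ?_ Metric.isClosed_cthickening
    refine (support_convolution_subset (lsmul ℝ ℝ)).trans ?_
    rintro _ ⟨y, hy, z, hz, rfl⟩
    rw [(b n).support_normed_eq, mem_ball_zero_iff] at hy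
    refine Metric.mem_cthickening_of_dist_le _ z _ _ (subset_closure hz) ?_
    rw [dist_eq_norm]
    simpa using hy.le.trans (hbδ n)
  have hKc : IsCompact (Metric.cthickening δ (tsupport η)) := hc.isCompact.cthickening
  refine ⟨Metric.cthickening δ (tsupport η), max (3 * C₀) (3 * C₁), ψ, hKc, hδU,
    fun n => ⟨?_, ?_, (hsupp n).trans hδU, ?_⟩, hsupp, ?_, ?_, ?_, ?_⟩
  · exact (b n).hasCompactSupport_normed.contDiff_convolution_left _ (b n).contDiff_normed
      hη.continuous.locallyIntegrable
  · exact hKc.of_isClosed_subset (isClosed_tsupport _) (hsupp n)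
  · intro x
    exact integral_nonneg fun t => mul_nonneg ((b n).nonneg_normed t) (h0 _)
  · exact fun n x => (hbound n η C₀ hη.continuous (fun x => hC₀ x) x).trans (le_max_left _ _)
  · intro n x v
    rw [hfd]
    refine (hbound n _ (C₁ * ‖v‖) (hdη.clm_apply continuous_const) (fun y => ?_) x).trans ?_
    · exact (ContinuousLinearMap.le_opNorm _ _).trans
        (mul_le_mul_of_nonneg_right (hC₁ y) (norm_nonneg _))
    · rw [← mul_assoc]
      exact mul_le_mul_of_nonneg_right (le_max_right _ _) (norm_nonneg _)
  · exact fun x => ContDiffBump.convolution_tendsto_right_of_continuous hb hη.continuous x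
  · intro x v
    simp_rw [hfd]
    exact ContDiffBump.convolution_tendsto_right_of_continuous hb
      (hdη.clm_apply continuous_const) x

theorem fderiv_eq_zero_of_notMem_tsupport {d : ℕ} {φ : E d → ℝ} {x : E d} (hx : x ∉ tsupport φ) :
    fderiv ℝ φ x = 0 :=
  image_eq_zero_of_notMem_tsupport fun h => hx (tsupport_fderiv_subset ℝ h)

theorem integrable_fderiv_apply {d : ℕ} {U : Set (E d)} (hU : IsOpen U) {F : E d → E d}
    (hF : ContinuousOn F U) {φ : E d → ℝ} (hφ : ContDiff ℝ 1 φ) (hc : HasCompactSupport φ)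
    (hs : tsupport φ ⊆ U) : Integrable fun x => fderiv ℝ φ x (F x) := by
  have hd : Continuous (fderiv ℝ φ) := hφ.continuous_fderiv one_ne_zero
  refine Continuous.integrable_of_hasCompactSupport ?_ ?_
  · rw [continuous_iff_continuousAt]
    intro x
    by_cases hx : x ∈ tsupport φ
    · exact hd.continuousAt.clm_apply (hF.continuousAt (hU.mem_nhds (hs hx)))
    · refine (continuousAt_const (y := (0 : ℝ))).congr ?_
      filter_upwards [(isClosed_tsupport φ).isOpen_compl.mem_nhds hx] with y hy
      rw [fderiv_eq_zero_of_notMem_tsupport hy, zero_apply]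
  · refine HasCompactSupport.intro hc.isCompact fun x hx => ?_
    rw [fderiv_eq_zero_of_notMem_tsupport hx, zero_apply]

theorem integrable_mul_test {d : ℕ} {q φ : E d → ℝ} (hq : IntegrableOn q (tsupport φ))
    (hφ : Continuous φ) (hc : HasCompactSupport φ) : Integrable fun x => q x * φ x := by
  refine (integrableOn_iff_integrable_of_support_subset (s := tsupport φ) fun x hx => ?_).1
    (hq.mul_continuousOn hφ.continuousOn hc.isCompact)
  by_contra h
  exact hx (by simp [image_eq_zero_of_notMem_tsupport h])

/-- A weak inequality tested against smooth functions extends to `C^1` test functions. -/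
theorem weak_le_of_smooth {d : ℕ} {U : Set (E d)} (hU : IsOpen U) {F : E d → E d} {q : E d → ℝ}
    (hF : ContinuousOn F U) (hq : ∀ K, IsCompact K → K ⊆ U → IntegrableOn q K)
    (h : ∀ φ, IsNonnegTest U φ → ∫ x in U, (fderiv ℝ φ x (F x) + q x * φ x) ≤ 0)
    {η : E d → ℝ} (hη : ContDiff ℝ 1 η) (hc : HasCompactSupport η) (hs : tsupport η ⊆ U)
    (h0 : ∀ x, 0 ≤ η x) :
    ∫ x, fderiv ℝ η x (F x) ≤ ∫ x, -q x * η x := by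
  obtain ⟨K, C, ψ, hK, hKU, hψ, hψK, hb, hbd, hlim, hlimd⟩ := exists_smooth_approx hU hη hc hs h0
  have hint : ∀ φ : E d → ℝ, ContDiff ℝ 1 φ → HasCompactSupport φ → tsupport φ ⊆ U →
      Integrable (fun x => fderiv ℝ φ x (F x)) ∧ Integrable (fun x => q x * φ x) :=
    fun φ hφ hφc hφU => ⟨integrable_fderiv_apply hU hF hφ hφc hφU,
      integrable_mul_test (hq _ hφc.isCompact hφU) hφ.continuous hφc⟩
  have hψ1 : ∀ n, ContDiff ℝ 1 (ψ n) := fun n => (hψ n).smooth.of_le (by simp)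
  have hle : ∫ x in U, (fderiv ℝ η x (F x) + q x * η x) ≤ 0 := by
    refine le_of_tendsto' (tendsto_integral_of_dominated_convergence
      (K.indicator fun x => C * ‖F x‖ + ‖q x‖ * C) (fun n => ?_) ?_ (fun n => ?_) ?_)
      fun n => h _ (hψ n)
    · obtain ⟨h1, h2⟩ := hint _ (hψ1 n) (hψ n).compactSupport (hψ n).support_subset
      exact (h1.add h2).aestronglyMeasurable.restrict
    · refine Integrable.integrableOn ?_
      rw [integrable_indicator_iff hK.measurableSet]
      exact (((hF.mono hKU).norm.integrableOn_compact hK).const_mul C).add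
        ((hq K hK hKU).norm.mul_const C)
    · refine Eventually.of_forall fun x => ?_
      by_cases hx : x ∈ K
      · rw [indicator_of_mem hx]
        refine (norm_add_le _ _).trans (add_le_add (hbd n x _) ?_)
        rw [norm_mul]
        exact mul_le_mul_of_nonneg_left (hb n x) (norm_nonneg _)
      · rw [indicator_of_notMem hx]
        have hx' : x ∉ tsupport (ψ n) := fun h => hx (hψK n h)
        simp [image_eq_zero_of_notMem_tsupport hx', fderiv_eq_zero_of_notMem_tsupport hx']
    · exact Eventually.of_forall fun x => (hlimd x _).add ((hlim x).const_mul _)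
  -- The integrand vanishes off the support of `η`, so the integral over `U` is one over the whole
  -- space.
  rw [setIntegral_eq_integral_of_forall_compl_eq_zero fun x hx => by
    have hx' : x ∉ tsupport η := fun h => hx (hs h)
    simp [image_eq_zero_of_notMem_tsupport hx', fderiv_eq_zero_of_notMem_tsupport hx']] at hle
  obtain ⟨h1, h2⟩ := hint η hη hc hs
  rw [integral_add h1 h2] at hle
  simp_rw [neg_mul]
  rw [integral_neg]
  linarith

/-! ### Weak comparison principle on annuli. -/

theorem continuousOn_gradient {d : ℕ} {U : Set (E d)} (hU : IsOpen U) {v : E d → ℝ}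
    (hv : ContDiffOn ℝ 1 v U) : ContinuousOn (gradient v) U :=
  (InnerProductSpace.toDual ℝ (E d)).symm.continuous.comp_continuousOn
    (hv.continuousOn_fderiv_of_isOpen hU le_rfl)

theorem isOpen_annulus (d : ℕ) (a b : ℝ) : IsOpen {x : E d | ‖x‖ ∈ Ioo a b} :=
  isOpen_Ioo.preimage continuous_norm

theorem isCompact_closedAnnulus (d : ℕ) (a b : ℝ) : IsCompact {x : E d | ‖x‖ ∈ Icc a b} := by
  refine Metric.isCompact_of_isClosed_isBounded (isClosed_Icc.preimage continuous_norm) ?_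
  exact Metric.isBounded_closedBall.subset fun x hx => mem_closedBall_zero_iff.2 hx.2

/-- Weak comparison principle for the `p`-Laplacian on an annulus: if `-Δ_p v ≤ f₁`,
`f₂ ≤ -Δ_p w` weakly, `f₁ < f₂` wherever `w < v`, and `v < w` on the boundary, then `v ≤ w`. -/
theorem comparison {d : ℕ} {p : ℝ} (hp : 1 < p) {a b : ℝ} {U : Set (E d)}
    (hU : IsOpen U) (hKU : {x : E d | ‖x‖ ∈ Icc a b} ⊆ U) {v w : E d → ℝ}
    (hv : ContDiffOn ℝ 1 v U) (hw : ContDiffOn ℝ 1 w U) {f₁ f₂ : E d → ℝ}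
    (hf₁ : IntegrableOn f₁ {x : E d | ‖x‖ ∈ Icc a b})
    (hf₂ : IntegrableOn f₂ {x : E d | ‖x‖ ∈ Icc a b})
    (hvf : ∀ η : E d → ℝ, ContDiff ℝ 1 η → HasCompactSupport η →
      tsupport η ⊆ {x : E d | ‖x‖ ∈ Ioo a b} → (∀ x, 0 ≤ η x) →
      ∫ x, fderiv ℝ η x (pField p (gradient v x)) ≤ ∫ x, f₁ x * η x)
    (hwf : ∀ η : E d → ℝ, ContDiff ℝ 1 η → HasCompactSupport η →
      tsupport η ⊆ {x : E d | ‖x‖ ∈ Ioo a b} → (∀ x, 0 ≤ η x) →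
      ∫ x, f₂ x * η x ≤ ∫ x, fderiv ℝ η x (pField p (gradient w x)))
    (hbd : ∀ x : E d, ‖x‖ = a ∨ ‖x‖ = b → v x < w x)
    (hlt : ∀ᵐ x : E d, ‖x‖ ∈ Ioo a b → w x < v x → f₁ x < f₂ x) :
    ∀ x : E d, ‖x‖ ∈ Ioo a b → v x ≤ w x := by
  classical
  by_contra! hcon
  obtain ⟨x₀, hx₀, hvw₀⟩ := hcon
  set A : Set (E d) := {x : E d | ‖x‖ ∈ Ioo a b} with hA
  set K : Set (E d) := {x : E d | ‖x‖ ∈ Icc a b} with hK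
  have hAK : A ⊆ K := fun x hx => Ioo_subset_Icc_self hx
  have hKc : IsCompact K := isCompact_closedAnnulus d a b
  have hAo : IsOpen A := isOpen_annulus d a b
  have hvc := hv.continuousOn
  have hwc := hw.continuousOn
  -- A `C^1` substitute for the positive part of `v - w`: `expNegInvGlue` is smooth, monotone, zero
  -- on `(-∞, 0]` and positive on `(0, ∞)`. The strict boundary inequality keeps the support inside
  -- the open annulus.
  let η : E d → ℝ := fun x => if x ∈ K then expNegInvGlue (v x - w x) else 0
  have hηA : ∀ x ∈ A, η =ᶠ[𝓝 x] fun y => expNegInvGlue (v y - w y) := by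
    intro x hx
    filter_upwards [hAo.mem_nhds hx] with y hy
    simp [η, hAK hy]
  have hη0 : ∀ x ∉ A, η =ᶠ[𝓝 x] fun _ => 0 := by
    intro x hx
    by_cases hxK : x ∈ K
    · have hb : v x < w x := by
        apply hbd
        by_contra! h
        exact hx ⟨lt_of_le_of_ne hxK.1 h.1.symm, lt_of_le_of_ne hxK.2 h.2⟩
      have hUx := hU.mem_nhds (hKU hxK)
      filter_upwards [(hvc.continuousAt hUx).eventually_lt (hwc.continuousAt hUx) hb] with y hy
      by_cases hyK : y ∈ K
      · simp [η, hyK, hy.le]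
      · simp [η, hyK]
    · filter_upwards [hKc.isClosed.isOpen_compl.mem_nhds hxK] with y hy
      exact if_neg hy
  have hη : ContDiff ℝ 1 η := by
    rw [contDiff_iff_contDiffAt]
    intro x
    by_cases hx : x ∈ A
    · refine ContDiffAt.congr_of_eventuallyEq ?_ (hηA x hx)
      have hUx := hU.mem_nhds (hKU (hAK hx))
      exact (expNegInvGlue.contDiff (n := 1)).contDiffAt.comp x
        ((hv.contDiffAt hUx).sub (hw.contDiffAt hUx))
    · exact contDiffAt_const.congr_of_eventuallyEq (hη0 x hx)
  have hηs : tsupport η ⊆ A := by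
    intro x hx
    by_contra h
    exact notMem_tsupport_iff_eventuallyEq.2 (hη0 x h) hx
  have hηc : HasCompactSupport η :=
    hKc.of_isClosed_subset (isClosed_tsupport _) (hηs.trans hAK)
  have hηn : ∀ x, 0 ≤ η x := fun x => by
    by_cases h : x ∈ K
    · simpa [η, h] using expNegInvGlue.nonneg _
    · simp [η, h]
  have hfd : ∀ x ∈ A, fderiv ℝ η x =
      deriv expNegInvGlue (v x - w x) • (fderiv ℝ v x - fderiv ℝ w x) := by
    intro x hx
    have hUx := hU.mem_nhds (hKU (hAK hx))
    have h1 := ((hv.contDiffAt hUx).differentiableAt one_ne_zero).hasFDerivAt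
    have h2 := ((hw.contDiffAt hUx).differentiableAt one_ne_zero).hasFDerivAt
    have h3 : HasDerivAt expNegInvGlue (deriv expNegInvGlue (v x - w x)) (v x - w x) :=
      ((expNegInvGlue.contDiff (n := 1)).differentiable one_ne_zero _).hasDerivAt
    rw [(hηA x hx).fderiv_eq]
    exact (h3.comp_hasFDerivAt x (h1.sub h2)).fderiv
  have hFv : ContinuousOn (fun x => pField p (gradient v x)) U :=
    (continuous_pField hp).comp_continuousOn (continuousOn_gradient hU hv)
  have hFw : ContinuousOn (fun x => pField p (gradient w x)) U :=
    (continuous_pField hp).comp_continuousOn (continuousOn_gradient hU hw)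
  have hηU : tsupport η ⊆ U := hηs.trans (hAK.trans hKU)
  have hmono : ∫ x, fderiv ℝ η x (pField p (gradient w x)) ≤
      ∫ x, fderiv ℝ η x (pField p (gradient v x)) := by
    refine integral_mono (integrable_fderiv_apply hU hFw hη hηc hηU)
      (integrable_fderiv_apply hU hFv hη hηc hηU) fun x => ?_
    by_cases hx : x ∈ A
    · have h1 := pField_monotone hp (gradient v x) (gradient w x)
      rw [inner_sub_right, inner_gradient_right, inner_gradient_right, conj_trivial,
        conj_trivial] at h1
      have h2 : 0 ≤ deriv expNegInvGlue (v x - w x) := expNegInvGlue.monotone.deriv_nonneg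
      have h3 := mul_nonneg h2 h1
      simp only [hfd x hx]
      simp only [smul_apply, sub_apply, smul_eq_mul,
        map_sub] at h3 ⊢
      nlinarith
    · have : fderiv ℝ η x = 0 := fderiv_eq_zero_of_notMem_tsupport fun h => hx (hηs h)
      simp [this]
  have hi₁ := integrable_mul_test (hf₁.mono_set (hηs.trans hAK)) hη.continuous hηc
  have hi₂ := integrable_mul_test (hf₂.mono_set (hηs.trans hAK)) hη.continuous hηc
  -- Monotonicity of the field gives this inequality, while `f₁ < f₂` wherever `η > 0`. Hence `η =
  -- 0` almost everywhere, and everywhere by continuity, against `η x₀ > 0`.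
  have hle : ∫ x, (f₂ x * η x - f₁ x * η x) ≤ 0 := by
    rw [integral_sub hi₂ hi₁]
    linarith [hvf η hη hηc hηs hηn, hwf η hη hηc hηs hηn]
  have hpos : ∀ x, 0 < η x → x ∈ A ∧ w x < v x := by
    intro x hx
    have hxA : x ∈ A := hηs (subset_closure (Function.mem_support.2 hx.ne'))
    refine ⟨hxA, ?_⟩
    rw [(hηA x hxA).eq_of_nhds] at hx
    by_contra! h
    simp [expNegInvGlue.zero_of_nonpos (sub_nonpos.2 h)] at hx
  have hae : 0 ≤ᵐ[volume] fun x => f₂ x * η x - f₁ x * η x := by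
    filter_upwards [hlt] with x hx
    rcases (hηn x).eq_or_lt with h | h
    · simp [← h]
    · obtain ⟨h1, h2⟩ := hpos x h
      have := mul_pos (sub_pos.2 (hx h1 h2)) h
      simp only [Pi.zero_apply]
      nlinarith
  have hz := (integral_eq_zero_iff_of_nonneg_ae hae (hi₂.sub hi₁)).1
    (le_antisymm hle (integral_nonneg_of_ae hae))
  have hηz : ∀ᵐ x, η x = 0 := by
    filter_upwards [hlt, hz] with x hx hzx
    by_contra hne
    have h : 0 < η x := (hηn x).lt_of_ne (Ne.symm hne)
    obtain ⟨h1, h2⟩ := hpos x h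
    have := mul_pos (sub_pos.2 (hx h1 h2)) h
    simp only [Pi.zero_apply] at hzx
    nlinarith
  have hzero : η = fun _ => 0 :=
    (hη.continuous.ae_eq_iff_eq (μ := volume) continuous_const).1 hηz
  have h1 := (hηA x₀ hx₀).eq_of_nhds
  rw [hzero] at h1
  exact (expNegInvGlue.pos_of_pos (sub_pos.2 hvw₀)).ne h1

/-! ### The weak inequalities for positive sub- and supersolutions. -/

theorem integrableOn_potential {d : ℕ} {p : ℝ} {V u : E d → ℝ} {U : Set (E d)}
    (hV : LocBounded V U) (hu : ContinuousOn u U) (hpos : ∀ x ∈ U, 0 < u x) {K : Set (E d)}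
    (hK : IsCompact K) (hKU : K ⊆ U) :
    IntegrableOn (fun x => V x * |u x| ^ (p - 2) * u x) K := by
  have : IsFiniteMeasure (volume.restrict K) := ⟨by simpa using hK.measure_lt_top⟩
  have hVi : IntegrableOn V K := (hV K hK hKU).integrable le_top
  have huK := hu.mono hKU
  refine (hVi.mul_continuousOn ?_ hK).mul_continuousOn huK hK
  -- Positivity of `u` keeps this power continuous even if `p - 2` is negative.
  exact huK.abs.rpow_const fun x hx => Or.inl (abs_pos.2 (hpos x (hKU hx)).ne').ne'

theorem weakForm_eq {d : ℕ} (p : ℝ) (V : E d → ℝ) (U : Set (E d)) (v φ : E d → ℝ) :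
    weakForm p V U v φ = ∫ x in U, (fderiv ℝ φ x (pField p (gradient v x)) +
      V x * |v x| ^ (p - 2) * v x * φ x) := by
  simp only [weakForm, pField, map_smul, smul_eq_mul, inner_gradient_right, conj_trivial]

theorem IsSubsolution.weak_le {d : ℕ} {p : ℝ} (hp : 1 < p) {V u : E d → ℝ} {U : Set (E d)}
    (hU : IsOpen U) (hV : LocBounded V U) (hpos : ∀ x ∈ U, 0 < u x) (hu : IsSubsolution p V U u)
    {η : E d → ℝ} (hη : ContDiff ℝ 1 η) (hc : HasCompactSupport η) (hs : tsupport η ⊆ U)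
    (h0 : ∀ x, 0 ≤ η x) :
    ∫ x, fderiv ℝ η x (pField p (gradient u x)) ≤
      ∫ x, -(V x * |u x| ^ (p - 2) * u x) * η x :=
  weak_le_of_smooth hU (F := fun x => pField p (gradient u x))
    ((continuous_pField hp).comp_continuousOn (continuousOn_gradient hU hu.1))
    (fun _ hK hKU => integrableOn_potential hV hu.1.continuousOn hpos hK hKU)
    (fun φ hφ => by rw [← weakForm_eq]; exact hu.2 φ hφ) hη hc hs h0

theorem IsSupersolution.le_weak {d : ℕ} {p : ℝ} (hp : 1 < p) {V u : E d → ℝ} {U : Set (E d)}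
    (hU : IsOpen U) (hV : LocBounded V U) (hpos : ∀ x ∈ U, 0 < u x)
    (hu : IsSupersolution p V U u)
    {η : E d → ℝ} (hη : ContDiff ℝ 1 η) (hc : HasCompactSupport η) (hs : tsupport η ⊆ U)
    (h0 : ∀ x, 0 ≤ η x) :
    ∫ x, -(V x * |u x| ^ (p - 2) * u x) * η x ≤
      ∫ x, fderiv ℝ η x (pField p (gradient u x)) := by
  -- Changing the sign of both the field and the potential term turns the supersolution inequality
  -- into the form already treated.
  have h := weak_le_of_smooth hU (F := fun x => -pField p (gradient u x))
    (q := fun x => -(V x * |u x| ^ (p - 2) * u x))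
    ((continuous_pField hp).comp_continuousOn (continuousOn_gradient hU hu.1)).neg
    (fun _ hK hKU => (integrableOn_potential hV hu.1.continuousOn hpos hK hKU).neg)
    (fun φ hφ => by
      have h := hu.2 φ hφ
      rw [weakForm_eq, ← neg_nonpos, ← integral_neg] at h
      refine le_of_eq_of_le (integral_congr_ae (Eventually.of_forall fun x => ?_)) h
      simp only [map_neg]
      ring) hη hc hs h0
  simp only [map_neg, neg_neg, integral_neg] at h
  simp only [neg_mul, integral_neg]
  linarith

/-! ### Affine functions of a radial profile as barriers. -/

/-- A radial profile `W` on the interval `J` with `Δ_p W = θ k G`, `θ = ±1`, where `w = W'`. -/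
structure IsProfile (d : ℕ) (p : ℝ) (J : Set ℝ) (G W w : ℝ → ℝ) (θ k : ℝ) : Prop where
  isOpen : IsOpen J
  subset_pos : J ⊆ Ioi 0
  hasDerivAt : ∀ r ∈ J, HasDerivAt W (w r) r
  continuousOn_deriv : ContinuousOn w J
  flux : ∀ r ∈ J,
    HasDerivAt (fun s => |w s| ^ (p - 2) * w s * s ^ (d - 1)) (θ * k * (G r * r ^ (d - 1))) r
  continuousOn : ContinuousOn G J
  pos : ∀ r ∈ J, 0 < G r
  abs_sign : |θ| = 1
  const_pos : 0 < k

section Profile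

variable {d : ℕ} {p : ℝ} {J : Set ℝ} {G W w : ℝ → ℝ} {θ k : ℝ}

theorem IsProfile.isOpen_radial (hW : IsProfile d p J G W w θ k) : IsOpen {x : E d | ‖x‖ ∈ J} :=
  hW.isOpen.preimage continuous_norm

theorem IsProfile.ne_zero (hW : IsProfile d p J G W w θ k) {x : E d} (hx : ‖x‖ ∈ J) : x ≠ 0 :=
  norm_pos_iff.1 (hW.subset_pos hx)

theorem IsProfile.contDiffOn (hW : IsProfile d p J G W w θ k) (A B : ℝ) :
    ContDiffOn ℝ 1 (fun x : E d => A + B * W ‖x‖) {x : E d | ‖x‖ ∈ J} := fun _ hx =>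
  (contDiffAt_const.add (contDiffAt_const.mul (contDiffAt_comp_norm hW.isOpen
    (contDiffOn_one_of_hasDerivAt hW.isOpen hW.hasDerivAt hW.continuousOn_deriv)
    (hW.ne_zero hx) hx))).contDiffWithinAt

theorem IsProfile.gradient_eq (hW : IsProfile d p J G W w θ k) (A B : ℝ) {x : E d}
    (hx : ‖x‖ ∈ J) :
    gradient (fun x : E d => A + B * W ‖x‖) x = (B * w ‖x‖ / ‖x‖) • x := by
  have h1 : HasDerivAt (fun r => A + B * W r) (B * w ‖x‖) ‖x‖ :=
    ((hW.hasDerivAt _ hx).const_mul B).const_add A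
  have h2 := hasFDerivAt_comp_norm (hW.ne_zero hx) h1
  refine HasGradientAt.gradient (hasGradientAt_iff_hasFDerivAt.2 (h2.congr_fderiv ?_))
  ext y
  simp

/-- This writes the flux as `H(|x|) |x|^{-d} x`, the form required by `integral_radial_field`, with
`H` a constant multiple of the quantity differentiated in `IsProfile.flux`. -/
theorem IsProfile.pField_gradient (hd : 0 < d) (hW : IsProfile d p J G W w θ k) (A B : ℝ)
    {x : E d} (hx : ‖x‖ ∈ J) :
    pField p (gradient (fun x : E d => A + B * W ‖x‖) x) =
      ((|B| ^ (p - 2) * B * (|w ‖x‖| ^ (p - 2) * w ‖x‖ * ‖x‖ ^ (d - 1))) / ‖x‖ ^ d) • x := by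
  have hx0 : 0 < ‖x‖ := hW.subset_pos hx
  have hn : ‖(B * w ‖x‖ / ‖x‖) • x‖ = |B| * |w ‖x‖| := by
    rw [norm_smul, Real.norm_eq_abs, abs_div, abs_mul, abs_norm]
    field_simp
  rw [hW.gradient_eq A B hx, pField, hn, smul_smul, Real.mul_rpow (abs_nonneg _) (abs_nonneg _)]
  congr 1
  have : ‖x‖ ^ d = ‖x‖ ^ (d - 1) * ‖x‖ := by rw [← pow_succ, Nat.sub_add_cancel hd]
  rw [this]
  field_simp

/-- The weak form of `-Δ_p (A + B W) = -|B|^{p-2} B θ k G`. -/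
theorem IsProfile.integral_eq (hd : 0 < d) (hW : IsProfile d p J G W w θ k) (A B : ℝ)
    {η : E d → ℝ} (hη : ContDiff ℝ 1 η) (hc : HasCompactSupport η)
    (hs : ∀ x ∈ tsupport η, ‖x‖ ∈ J) :
    ∫ x, fderiv ℝ η x (pField p (gradient (fun x : E d => A + B * W ‖x‖) x)) =
      ∫ x, -(|B| ^ (p - 2) * B * θ * k * G ‖x‖) * η x := by
  have hH : ∀ r ∈ J, HasDerivAt
      (fun r => |B| ^ (p - 2) * B * (|w r| ^ (p - 2) * w r * r ^ (d - 1)))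
      (|B| ^ (p - 2) * B * (θ * k * (G r * r ^ (d - 1)))) r := fun r hr =>
    (hW.flux r hr).const_mul _
  have hcont : ContinuousOn (fun r => |B| ^ (p - 2) * B * (θ * k * (G r * r ^ (d - 1)))) J :=
    continuousOn_const.mul (continuousOn_const.mul (hW.continuousOn.mul (continuousOn_id.pow _)))
  have h := integral_radial_field hW.isOpen hW.subset_pos hH hcont hη hc hs
  rw [← integral_neg] at h
  convert h using 2
  · funext x
    by_cases hx : x ∈ tsupport η
    · rw [hW.pField_gradient hd A B (hs x hx)]
    · simp [fderiv_eq_zero_of_notMem_tsupport hx]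
  · funext x
    by_cases hx : x ∈ tsupport η
    · have hx0 : 0 < ‖x‖ := hW.subset_pos (hs x hx)
      have : ‖x‖ ^ d = ‖x‖ ^ (d - 1) * ‖x‖ := by rw [← pow_succ, Nat.sub_add_cancel hd]
      rw [this]
      field_simp
    · simp [image_eq_zero_of_notMem_tsupport hx]

/-- Used with `σ = ±1`, the sign of `θ B`: it reduces the coefficient in `IsProfile.integral_eq` to
`±|B|^{p-1}`. -/
theorem abs_rpow_sub_two_mul {B : ℝ} (hB : B ≠ 0) {σ : ℝ} (hσ : θ * B = σ * |B|) :
    |B| ^ (p - 2) * B * θ = σ * |B| ^ (p - 1) := by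
  have : |B| ^ (p - 1) = |B| ^ (p - 2) * |B| := by
    rw [← Real.rpow_add_one (abs_pos.2 hB).ne']; congr 1; ring
  rw [this, mul_assoc, mul_comm B θ, hσ]; ring

theorem IsProfile.integrableOn (hW : IsProfile d p J G W w θ k) {a b : ℝ} (hab : Icc a b ⊆ J)
    (C : ℝ) : IntegrableOn (fun x : E d => C * G ‖x‖) {x : E d | ‖x‖ ∈ Icc a b} :=
  ContinuousOn.integrableOn_compact (isCompact_closedAnnulus d a b)
    (continuousOn_const.mul ((hW.continuousOn.mono hab).comp continuous_norm.continuousOn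
      fun _ hx => hx))

variable {a b A B N : ℝ} {U : Set (E d)} {V u : E d → ℝ}

theorem abs_potential_le {x : E d} (hu : 0 < u x) {g : ℝ} (hV : |V x| ≤ g) :
    |V x * |u x| ^ (p - 2) * u x| ≤ g * u x ^ (p - 1) := by
  have : |u x| ^ (p - 2) * u x = u x ^ (p - 1) := by
    rw [abs_of_pos hu, ← Real.rpow_add_one hu.ne']; congr 1; ring
  rw [mul_assoc, this, abs_mul, abs_of_pos (Real.rpow_pos_of_pos hu _)]
  exact mul_le_mul_of_nonneg_right hV (Real.rpow_pos_of_pos hu _).le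

/-- A supersolution dominates `A + B W` on an annulus if it does so on the boundary. -/
theorem IsSupersolution.le_of_boundary (hd : 0 < d) (hp : 1 < p)
    (hW : IsProfile d p J G W w θ k) (hU : IsOpen U) (hV : LocBounded V U)
    (hpos : ∀ x ∈ U, 0 < u x) (hu : IsSupersolution p V U u) (hJ : Icc a b ⊆ J)
    (hKU : {x : E d | ‖x‖ ∈ Icc a b} ⊆ U)
    (hVG : ∀ᵐ x : E d, ‖x‖ ∈ Ioo a b → |V x| ≤ G ‖x‖)
    (hB : 0 < θ * B) (hN : ∀ r ∈ Icc a b, A + B * W r ≤ N)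
    (hBN : N ^ (p - 1) < |B| ^ (p - 1) * k)
    (hbd : ∀ x : E d, ‖x‖ = a ∨ ‖x‖ = b → A + B * W ‖x‖ ≤ u x) {x : E d} (hx : ‖x‖ ∈ Ioo a b) :
    A + B * W ‖x‖ ≤ u x := by
  have hB0 : B ≠ 0 := by rintro rfl; simp at hB
  have hsign : θ * B = 1 * |B| := by
    rw [← abs_of_pos hB, abs_mul, hW.abs_sign]
  -- Lowering the barrier by `ε` makes the boundary inequality strict and does not change its
  -- `p`-Laplacian.
  refine le_of_forall_pos_sub_le fun ε hε => ?_
  have hAK : {x : E d | ‖x‖ ∈ Ioo a b} ⊆ {x : E d | ‖x‖ ∈ Icc a b} :=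
    fun x hx => Ioo_subset_Icc_self hx
  have h := comparison (a := a) (b := b) (v := fun x : E d => (A - ε) + B * W ‖x‖) (w := u)
    (f₁ := fun x => -(|B| ^ (p - 2) * B * θ * k * G ‖x‖))
    (f₂ := fun x => -(V x * |u x| ^ (p - 2) * u x)) hp
    (hU.inter hW.isOpen_radial) (fun x hx => ⟨hKU hx, hJ hx⟩)
    ((hW.contDiffOn (A - ε) B).mono inter_subset_right) (hu.1.mono inter_subset_left)
    (hW.integrableOn hJ _).neg
    (integrableOn_potential hV hu.1.continuousOn hpos (isCompact_closedAnnulus d a b) hKU).neg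
    (fun η hη hc hs _ => (hW.integral_eq hd _ B hη hc fun x hx => hJ (hAK (hs hx))).le)
    (fun η hη hc hs h0 => hu.le_weak hp hU hV hpos hη hc (hs.trans (hAK.trans hKU)) h0)
    (fun x hx => by have := hbd x hx; linarith) ?_ x hx
  · linarith
  -- Only points where `u` lies below the barrier matter; there `u ≤ N`, so `V u^{p-1} ≤ G N^{p-1} <
  -- |B|^{p-1} k G`.
  · filter_upwards [hVG] with x hx hxA hlt
    have hxK := hAK hxA
    have hux := hpos x (hKU hxK)
    have h1 := abs_potential_le (p := p) hux (hx hxA)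
    have hG := hW.pos _ (hJ hxK)
    have h2 : u x ^ (p - 1) ≤ N ^ (p - 1) :=
      Real.rpow_le_rpow hux.le (by have := hN _ hxK; linarith) (by linarith)
    have h3 := abs_rpow_sub_two_mul (p := p) hB0 hsign
    rw [h3, one_mul]
    have h4 := mul_lt_mul_of_pos_left (h2.trans_lt hBN) hG
    have h5 := le_abs_self (V x * |u x| ^ (p - 2) * u x)
    linarith

/-- A subsolution is dominated by `A + B W` on an annulus if this holds on the boundary. -/
theorem IsSubsolution.le_of_boundary (hd : 0 < d) (hp : 1 < p)
    (hW : IsProfile d p J G W w θ k) (hU : IsOpen U) (hV : LocBounded V U)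
    (hpos : ∀ x ∈ U, 0 < u x) (hu : IsSubsolution p V U u) (hJ : Icc a b ⊆ J)
    (hKU : {x : E d | ‖x‖ ∈ Icc a b} ⊆ U)
    (hVG : ∀ᵐ x : E d, ‖x‖ ∈ Ioo a b → |V x| ≤ G ‖x‖)
    (hB : θ * B < 0) (hN : ∀ r ∈ Icc a b, A + B * W r ≤ N)
    (hφ : ∀ r ∈ Icc a b, 0 < A + B * W r)
    (hBN : N ^ (p - 1) < |B| ^ (p - 1) * k)
    (hbd : ∀ x : E d, ‖x‖ = a ∨ ‖x‖ = b → u x ≤ A + B * W ‖x‖) {x : E d} (hx : ‖x‖ ∈ Ioo a b) :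
    u x ≤ A + B * W ‖x‖ := by
  have hB0 : B ≠ 0 := by rintro rfl; simp at hB
  have hAK : {x : E d | ‖x‖ ∈ Ioo a b} ⊆ {x : E d | ‖x‖ ∈ Icc a b} :=
    fun x hx => Ioo_subset_Icc_self hx
  have hK := isCompact_closedAnnulus d a b
  set φ : E d → ℝ := fun x => A + B * W ‖x‖ with hφdef
  have hφc : ContinuousOn φ {x : E d | ‖x‖ ∈ Icc a b} :=
    (hW.contDiffOn A B).continuousOn.mono fun x hx => hJ hx
  have huc := hu.1.continuousOn.mono hKU
  -- Where `u > φ` there is no a priori bound of `u` by `N`. The barrier is therefore rescaled by `τ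
  -- = max (u / φ)`: then `u ≤ τ φ ≤ τ N` on the whole annulus, and by homogeneity the slope
  -- condition survives the scaling.
  obtain ⟨y, hyK, hy⟩ := hK.exists_isMaxOn ⟨x, hAK hx⟩
    (huc.div hφc fun z hz => (hφ _ hz).ne')
  set τ : ℝ := u y / φ y with hτ
  have hφy : 0 < φ y := hφ _ hyK
  have hle : ∀ z : E d, ‖z‖ ∈ Icc a b → u z ≤ τ * φ z := by
    intro z hz
    have : u z / φ z ≤ τ := hy hz
    rwa [div_le_iff₀ (hφ _ hz)] at this
  by_contra! hcon
  have hτ1 : 1 < τ := by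
    have h1 := hle x (hAK hx)
    have h2 : 0 < φ x := hφ _ (hAK hx)
    by_contra! h
    nlinarith
  have hτ0 : 0 < τ := by linarith
  obtain ⟨z₀, hz₀K, hz₀⟩ := hK.exists_isMinOn ⟨x, hAK hx⟩ hφc
  have hφz₀ : 0 < φ z₀ := hφ _ hz₀K
  -- Smaller than `(τ - 1) φ` everywhere, so that `u ≤ φ < τ φ - ε` on the boundary.
  set ε : ℝ := (τ - 1) / 2 * φ z₀ with hε
  have hε0 : 0 < ε := mul_pos (by linarith) hφz₀
  have hsign : θ * (τ * B) = -1 * |τ * B| := by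
    have : θ * (τ * B) < 0 := by nlinarith
    have h2 := abs_of_neg this
    rw [abs_mul, hW.abs_sign] at h2
    linarith
  have hbd' : ∀ z : E d, ‖z‖ = a ∨ ‖z‖ = b → u z < (τ * A - ε) + τ * B * W ‖z‖ := by
    intro z hz
    have hzK : ‖z‖ ∈ Icc a b := by
      have hab : a ≤ b := (hx.1.trans hx.2).le
      rcases hz with h | h
      · rw [h]; exact left_mem_Icc.2 hab
      · rw [h]; exact right_mem_Icc.2 hab
    have h1 : u z ≤ φ z := hbd z hz
    have h2 : φ z₀ ≤ φ z := hz₀ hzK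
    have h3 : τ * φ z = τ * A + τ * B * W ‖z‖ := by simp only [hφdef]; ring
    nlinarith
  have h := comparison (a := a) (b := b) (w := fun x : E d => (τ * A - ε) + τ * B * W ‖x‖) (v := u)
    (f₂ := fun x => -(|τ * B| ^ (p - 2) * (τ * B) * θ * k * G ‖x‖))
    (f₁ := fun x => -(V x * |u x| ^ (p - 2) * u x)) hp
    (hU.inter hW.isOpen_radial) (fun x hx => ⟨hKU hx, hJ hx⟩)
    (hu.1.mono inter_subset_left)
    ((hW.contDiffOn (τ * A - ε) (τ * B)).mono inter_subset_right)
    (integrableOn_potential hV hu.1.continuousOn hpos (isCompact_closedAnnulus d a b) hKU).neg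
    (hW.integrableOn hJ _).neg
    (fun η hη hc hs h0 => hu.weak_le hp hU hV hpos hη hc (hs.trans (hAK.trans hKU)) h0)
    (fun η hη hc hs _ => (hW.integral_eq hd _ (τ * B) hη hc fun x hx => hJ (hAK (hs hx))).ge)
    hbd' ?_
  -- At the maximum point `u y = τ φ y`, which contradicts `u ≤ τ φ - ε`.
  · have hyle : u y ≤ (τ * A - ε) + τ * B * W ‖y‖ := by
      by_cases hyA : ‖y‖ ∈ Ioo a b
      · exact h y hyA
      · refine (hbd' y ?_).le
        by_contra! hne
        exact hyA ⟨lt_of_le_of_ne hyK.1 hne.1.symm, lt_of_le_of_ne hyK.2 hne.2⟩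
    have h3 : τ * φ y = τ * A + τ * B * W ‖y‖ := by simp only [hφdef]; ring
    have h4 : u y = τ * φ y := by rw [hτ, div_mul_cancel₀ _ hφy.ne']
    linarith
  · filter_upwards [hVG] with z hz hzA _
    have hzK := hAK hzA
    have huz := hpos z (hKU hzK)
    have h1 := abs_potential_le (p := p) huz (hz hzA)
    have hG := hW.pos _ (hJ hzK)
    have h2 : u z ^ (p - 1) ≤ τ ^ (p - 1) * N ^ (p - 1) := by
      have hN0 : φ z ≤ N := hN _ hzK
      have hφz : 0 < φ z := hφ _ hzK
      rw [← Real.mul_rpow hτ0.le (by linarith)]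
      exact Real.rpow_le_rpow huz.le
        ((hle z hzK).trans (mul_le_mul_of_nonneg_left hN0 hτ0.le)) (by linarith)
    have h3 := abs_rpow_sub_two_mul (p := p) (mul_ne_zero hτ0.ne' hB0) hsign
    rw [h3, abs_mul, Real.mul_rpow (abs_nonneg _) (abs_nonneg _), abs_of_pos hτ0]
    have hτp : 0 < τ ^ (p - 1) := Real.rpow_pos_of_pos hτ0 _
    have h4 := mul_lt_mul_of_pos_left (h2.trans_lt (mul_lt_mul_of_pos_left hBN hτp)) hG
    have h5 := neg_abs_le (V z * |u z| ^ (p - 2) * u z)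
    linarith

end Profile

/-! ### Signs, and one-dimensional integrals from `ζ`. -/

/-- The direction of increase of `|∫_ζ^r|`: `1` at the origin, `-1` at infinity. -/
def radialSign : SingularPoint → ℝ
  | .zero => 1
  | .infty => -1

/-- `1` in the classical cases and `-1` in the nonclassical ones. -/
noncomputable def classicalSign (d : ℕ) (p : ℝ) : SingularPoint → ℝ
  | .zero => if p ≤ d then 1 else -1
  | .infty => if (d : ℝ) ≤ p then 1 else -1

/-- `a` lies strictly between `ζ` and `b`. -/
def Closer : SingularPoint → ℝ → ℝ → Prop
  | .zero, a, b => a < b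
  | .infty, a, b => b < a

/-- The filter of radii tending to `ζ`. -/
def radiusNhds : SingularPoint → Filter ℝ
  | .zero => 𝓝[>] 0
  | .infty => atTop

theorem radialSign_mul_self (ζ : SingularPoint) : radialSign ζ * radialSign ζ = 1 := by
  cases ζ <;> simp [radialSign]

theorem abs_classicalSign (d : ℕ) (p : ℝ) (ζ : SingularPoint) : |classicalSign d p ζ| = 1 := by
  cases ζ <;> simp only [classicalSign] <;> split_ifs <;> simp

theorem isOpen_intervalTo (ζ : SingularPoint) (r : ℝ) : IsOpen (intervalTo ζ r) := by
  cases ζ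
  · exact isOpen_Ioo
  · exact isOpen_Ioi

theorem intervalTo_subset_pos (ζ : SingularPoint) {r : ℝ} (hr : 0 ≤ r) :
    intervalTo ζ r ⊆ Ioi 0 := by
  cases ζ
  · exact fun x hx => hx.1
  · exact fun x hx => hr.trans_lt hx

theorem intervalTo_subset (ζ : SingularPoint) {r s : ℝ} (hr : r ∈ intervalTo ζ s) :
    intervalTo ζ r ⊆ intervalTo ζ s := by
  cases ζ
  · exact Ioo_subset_Ioo_right hr.2.le
  · exact Ioi_subset_Ioi (le_of_lt hr)

theorem exists_between_intervalTo (ζ : SingularPoint) {r s : ℝ} (hr : r ∈ intervalTo ζ s) :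
    ∃ t ∈ intervalTo ζ s, r ∈ intervalTo ζ t := by
  cases ζ
  · obtain ⟨t, h1, h2⟩ := exists_between hr.2
    exact ⟨t, ⟨hr.1.trans h1, h2⟩, hr.1, h1⟩
  · obtain ⟨t, h1, h2⟩ := exists_between (show s < r from hr)
    exact ⟨t, h1, h2⟩

theorem setIntegral_Ioi_eq_sub {f : ℝ → ℝ} {s t : ℝ} (hst : s ≤ t) (hf : IntegrableOn f (Ioi s)) :
    ∫ x in Ioi t, f x = (∫ x in Ioi s, f x) - ∫ x in s..t, f x := by
  rw [eq_sub_iff_add_eq', intervalIntegral.integral_interval_add_Ioi hf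
    (hf.mono_set (Ioi_subset_Ioi hst))]

theorem hasDerivAt_setIntegral_intervalTo {ζ : SingularPoint} {f : ℝ → ℝ} {r s : ℝ} {J : Set ℝ}
    (hJ : IsOpen J) (hr : r ∈ J) (hrs : r ∈ intervalTo ζ s) (hf : ContinuousOn f J)
    (hi : IntegrableOn f (intervalTo ζ s)) :
    HasDerivAt (fun t => ∫ x in intervalTo ζ t, f x) (radialSign ζ * f r) r := by
  have hm := hf.stronglyMeasurableAtFilter (μ := volume) hJ r hr
  have hc := hf.continuousAt (hJ.mem_nhds hr)
  cases ζ
  · have h1 : IntervalIntegrable f volume 0 r := by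
      rw [intervalIntegrable_iff_integrableOn_Ioo_of_le hrs.1.le]
      exact hi.mono_set (intervalTo_subset .zero hrs)
    have h2 := intervalIntegral.integral_hasDerivAt_right h1 hm hc
    refine (h2.congr_of_eventuallyEq ?_).congr_deriv (by simp [radialSign])
    filter_upwards [lt_mem_nhds hrs.1] with t ht
    rw [intervalIntegral.integral_of_le ht.le, integral_Ioc_eq_integral_Ioo]
    rfl
  · have hsr : s < r := hrs
    have h1 : IntervalIntegrable f volume s r := by
      rw [intervalIntegrable_iff_integrableOn_Ioo_of_le hsr.le]
      exact hi.mono_set fun x hx => hx.1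
    have h2 := (intervalIntegral.integral_hasDerivAt_right h1 hm hc).const_sub
      (∫ x in Ioi s, f x)
    refine (h2.congr_of_eventuallyEq ?_).congr_deriv (by simp [radialSign])
    filter_upwards [lt_mem_nhds hsr] with t ht
    exact setIntegral_Ioi_eq_sub ht.le hi

theorem tendsto_setIntegral_intervalTo {ζ : SingularPoint} {f : ℝ → ℝ} {s : ℝ} (hs : 0 < s)
    (hi : IntegrableOn f (intervalTo ζ s)) :
    Tendsto (fun t => ∫ x in intervalTo ζ t, f x) (radiusNhds ζ) (𝓝 0) := by
  cases ζ
  · have hT : Tendsto (fun t => ∫ x in Ioo 0 t, f x ∂(volume.restrict (Ioo 0 s)))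
        (𝓝[>] 0) (𝓝 0) := by
      refine Integrable.tendsto_setIntegral_nhds_zero hi ?_
      refine tendsto_of_tendsto_of_tendsto_of_le_of_le tendsto_const_nhds
        (?_ : Tendsto (fun t : ℝ => ENNReal.ofReal t) (𝓝[>] 0) (𝓝 0)) (fun _ => zero_le)
        fun t => ?_
      · have := (ENNReal.continuous_ofReal.tendsto (0 : ℝ)).mono_left
          (nhdsWithin_le_nhds (s := Ioi 0))
        simpa using this
      · refine (Measure.restrict_apply_le _ _).trans ?_
        simp
    refine hT.congr' ?_
    filter_upwards [Ioo_mem_nhdsGT hs] with t ht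
    rw [Measure.restrict_restrict measurableSet_Ioo,
      inter_eq_left.2 (Ioo_subset_Ioo_right ht.2.le)]
    rfl
  · have h1 := (intervalIntegral_tendsto_integral_Ioi s hi tendsto_id).const_sub
      (∫ x in Ioi s, f x)
    rw [sub_self] at h1
    refine h1.congr' ?_
    filter_upwards [eventually_ge_atTop s] with t ht
    exact (setIntegral_Ioi_eq_sub ht hi).symm

theorem isOpen_innerInterval (d : ℕ) (p : ℝ) (ζ : SingularPoint) (t : ℝ) :
    IsOpen (innerInterval d p ζ t) := by
  cases ζ <;> simp only [innerInterval] <;> split_ifs <;> first | exact isOpen_Ioo | exact isOpen_Ioi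

theorem innerInterval_subset_pos (d : ℕ) (p : ℝ) {ζ : SingularPoint} {t : ℝ}
    (ht : t ∈ intervalTo ζ 1) : innerInterval d p ζ t ⊆ Ioi 0 := by
  have ht0 : 0 < t := intervalTo_subset_pos ζ zero_le_one ht
  cases ζ <;> simp only [innerInterval] <;> split_ifs <;> intro x hx
  · exact hx.1
  · exact ht0.trans hx.1
  · exact ht0.trans hx
  · exact zero_lt_one.trans hx.1

theorem innerInterval_nonempty (d : ℕ) (p : ℝ) {ζ : SingularPoint} {t : ℝ}
    (ht : t ∈ intervalTo ζ 1) : (innerInterval d p ζ t).Nonempty := by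
  cases ζ <;> simp only [innerInterval] <;> split_ifs
  · exact nonempty_Ioo.2 ht.1
  · exact nonempty_Ioo.2 ht.2
  · exact nonempty_Ioi
  · exact nonempty_Ioo.2 ht

theorem setIntegral_innerInterval_pos {d : ℕ} {p : ℝ} {ζ : SingularPoint} {t : ℝ} {f : ℝ → ℝ}
    (ht : t ∈ intervalTo ζ 1) (hf : ∀ s, 0 < s → 0 < f s)
    (hi : IntegrableOn f (innerInterval d p ζ t)) : 0 < ∫ s in innerInterval d p ζ t, f s := by
  have hsub := innerInterval_subset_pos d p ht
  have hm := (isOpen_innerInterval d p ζ t).measurableSet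
  rw [setIntegral_pos_iff_support_of_nonneg_ae
    ((ae_restrict_iff' hm).2 (Eventually.of_forall fun s hs => (hf s (hsub hs)).le)) hi]
  rw [inter_eq_right.2 fun s hs => Function.mem_support.2 (hf s (hsub hs)).ne']
  exact (isOpen_innerInterval d p ζ t).measure_pos volume (innerInterval_nonempty d p ht)

/-- The product of the two signs is `1` exactly when the interval grows with `t`: the classical case
at the origin and the nonclassical one at infinity. -/
theorem hasDerivAt_setIntegral_innerInterval {d : ℕ} {p : ℝ} {ζ : SingularPoint} {r : ℝ}
    {f : ℝ → ℝ} (hr : r ∈ intervalTo ζ 1) (hf : ContinuousOn f (Ioi 0))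
    (hi : ∀ t ∈ intervalTo ζ 1, IntegrableOn f (innerInterval d p ζ t)) :
    HasDerivAt (fun t => ∫ s in innerInterval d p ζ t, f s)
      (classicalSign d p ζ * radialSign ζ * f r) r := by
  have hr0 : r ∈ Ioi (0 : ℝ) := intervalTo_subset_pos ζ zero_le_one hr
  have hm := hf.stronglyMeasurableAtFilter (μ := volume) isOpen_Ioi r hr0
  have hc := hf.continuousAt (isOpen_Ioi.mem_nhds hr0)
  -- A radius farther from `ζ` than `r` provides integrability on a full neighbourhood of `r`.
  obtain ⟨s, hs, hrs⟩ := exists_between_intervalTo ζ hr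
  have his := hi s hs
  have hI : ∀ a b : ℝ, 0 < a → 0 < b → IntervalIntegrable f volume a b := fun a b ha hb =>
    (hf.mono fun x hx => (lt_min ha hb).trans_le hx.1).intervalIntegrable
  cases ζ <;> simp only [innerInterval, classicalSign] at his ⊢ <;> split_ifs at his ⊢ with h
  · rw [one_mul]
    exact hasDerivAt_setIntegral_intervalTo (ζ := .zero) isOpen_Ioi hr0 hrs hf his
  · have h2 := intervalIntegral.integral_hasDerivAt_left (hI r 1 hr0 one_pos) hm hc
    refine (h2.congr_of_eventuallyEq ?_).congr_deriv (by simp [radialSign])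
    filter_upwards [gt_mem_nhds hr.2] with t ht
    rw [intervalIntegral.integral_of_le ht.le, integral_Ioc_eq_integral_Ioo]
  · rw [one_mul]
    exact hasDerivAt_setIntegral_intervalTo (ζ := .infty) isOpen_Ioi hr0 hrs hf his
  · have h2 := intervalIntegral.integral_hasDerivAt_right (hI 1 r one_pos hr0) hm hc
    refine (h2.congr_of_eventuallyEq ?_).congr_deriv (by simp [radialSign])
    filter_upwards [lt_mem_nhds (show 1 < r from hr)] with t ht
    rw [intervalIntegral.integral_of_le ht.le, integral_Ioc_eq_integral_Ioo]

/-! ### The Wolff potential as a radial profile. -/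

/-- Polar coordinates for a radial function over a rotation-invariant set. -/
theorem setIntegral_radial {d : ℕ} (hd : 0 < d) (f : ℝ → ℝ) {S : Set ℝ} (hS : MeasurableSet S) :
    ∫ y in {y : E d | ‖y‖ ∈ S}, f ‖y‖ =
      d * (volume (Metric.ball (0 : E d) 1)).toReal *
        ∫ s in Ioi 0 ∩ S, f s * s ^ (d - 1) := by
  have : Nontrivial (E d) := by
    have : Nonempty (Fin d) := ⟨⟨0, hd⟩⟩
    infer_instance
  have hm : MeasurableSet {y : E d | ‖y‖ ∈ S} := measurable_norm hS
  have h := integral_fun_norm_addHaar (volume : Measure (E d)) (S.indicator f)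
  rw [← integral_indicator hm]
  have h1 : ({y : E d | ‖y‖ ∈ S}.indicator fun y => f ‖y‖) = fun y => S.indicator f ‖y‖ := by
    funext y
    by_cases hy : ‖y‖ ∈ S <;> simp [indicator, hy]
  rw [h1, h, finrank_euclideanSpace_fin, ← setIntegral_indicator hS]
  simp only [nsmul_eq_mul, smul_eq_mul, Measure.real, ← mul_assoc]
  congr 1
  refine integral_congr_ae (Eventually.of_forall fun s => ?_)
  by_cases hs : s ∈ S <;> simp [indicator, hs, mul_comm]

/-- Polar coordinates link the mass in the Wolff potential to the inner integral of (C1). The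
half-open intervals coming from `X_t` differ from open ones by a null set. -/
theorem setIntegral_wolffDomain {d : ℕ} (hd : 0 < d) (p : ℝ) {ζ : SingularPoint} (f : ℝ → ℝ)
    {t : ℝ} (ht : t ∈ intervalTo ζ 1) :
    ∫ y in wolffDomain d p ζ t, f ‖y‖ =
      d * (volume (Metric.ball (0 : E d) 1)).toReal *
        ∫ s in innerInterval d p ζ t, f s * s ^ (d - 1) := by
  have ht0 : 0 < t := intervalTo_subset_pos ζ zero_le_one ht
  cases ζ <;> simp only [wolffDomain, innerInterval] <;> split_ifs
  · have h1 : Metric.ball (0 : E d) t = {y | ‖y‖ ∈ Iio t} := by ext; simp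
    rw [h1, setIntegral_radial hd f measurableSet_Iio]
    rfl
  · have h1 : Metric.ball (0 : E d) 1 \ Metric.ball 0 t = {y | ‖y‖ ∈ Ico t 1} := by
      ext; simp [and_comm]
    rw [h1, setIntegral_radial hd f measurableSet_Ico, inter_eq_right.2 fun s hs =>
      mem_Ioi.2 (ht0.trans_le hs.1), integral_Ico_eq_integral_Ioo]
  · have h1 : (Metric.closedBall (0 : E d) t)ᶜ = {y | ‖y‖ ∈ Ioi t} := by ext; simp
    rw [h1, setIntegral_radial hd f measurableSet_Ioi, inter_eq_right.2 (Ioi_subset_Ioi ht0.le)]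
  · have h1 : Metric.ball (0 : E d) t \ Metric.ball 0 1 = {y | ‖y‖ ∈ Ico 1 t} := by
      ext; simp [and_comm]
    rw [h1, setIntegral_radial hd f measurableSet_Ico, inter_eq_right.2 fun s hs =>
      mem_Ioi.2 (one_pos.trans_le hs.1), integral_Ico_eq_integral_Ioo]

/-- The derivative of the Wolff potential. -/
noncomputable def wolffDeriv (d : ℕ) (p : ℝ) (ζ : SingularPoint) (g : ℝ → ℝ) (r : ℝ) : ℝ :=
  radialSign ζ * (1 / (volume (Metric.ball (0 : E d) 1)).toReal * (r ^ alphaStar d p *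
    (∫ y in wolffDomain d p ζ r, radialG p g ‖y‖) ^ (1 / (p - 1)) / r))

/-- The constant `k` in `Δ_p W = ± k G`. -/
noncomputable def wolffConst (d : ℕ) (p : ℝ) : ℝ :=
  (1 / (volume (Metric.ball (0 : E d) 1)).toReal) ^ (p - 1) *
    (d * (volume (Metric.ball (0 : E d) 1)).toReal)

theorem volume_unitBall_pos (d : ℕ) : 0 < (volume (Metric.ball (0 : E d) 1)).toReal :=
  ENNReal.toReal_pos (Metric.measure_ball_pos _ _ one_pos).ne' measure_ball_lt_top.ne

theorem wolffConst_pos {d : ℕ} (hd : 0 < d) (p : ℝ) : 0 < wolffConst d p := by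
  have := volume_unitBall_pos d
  have hd' : (0 : ℝ) < d := Nat.cast_pos.2 hd
  exact mul_pos (Real.rpow_pos_of_pos (by positivity) _) (by positivity)

section Wolff

variable {d : ℕ} {p : ℝ} {ζ : SingularPoint} {V : E d → ℝ} {g : ℝ → ℝ}

theorem SatisfiesC1.radialG_pos (hg : SatisfiesC1 d p ζ V g) {s : ℝ} (hs : 0 < s) :
    0 < radialG p g s := div_pos (hg.pos s hs) (Real.rpow_pos_of_pos hs _)

theorem SatisfiesC1.continuousOn_radialG (hg : SatisfiesC1 d p ζ V g) :
    ContinuousOn (radialG p g) (Ioi 0) :=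
  hg.continuous.div (continuousOn_id.rpow_const fun _ hs => Or.inl (ne_of_gt hs))
    fun _ hs => (Real.rpow_pos_of_pos hs _).ne'

theorem SatisfiesC1.hasDerivAt_mass (hd : 0 < d) (hg : SatisfiesC1 d p ζ V g) {r : ℝ}
    (hr : r ∈ intervalTo ζ 1) :
    HasDerivAt (fun t => ∫ y in wolffDomain d p ζ t, radialG p g ‖y‖)
      (d * (volume (Metric.ball (0 : E d) 1)).toReal *
        (classicalSign d p ζ * radialSign ζ * (radialG p g r * r ^ (d - 1)))) r := by
  have h := (hasDerivAt_setIntegral_innerInterval hr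
    (hg.continuousOn_radialG.mul (continuousOn_id.pow (d - 1))) hg.c1.inner_integrable).const_mul
      (d * (volume (Metric.ball (0 : E d) 1)).toReal)
  refine h.congr_of_eventuallyEq ?_
  filter_upwards [(isOpen_intervalTo ζ 1).mem_nhds hr] with t ht
  exact setIntegral_wolffDomain hd p (radialG p g) ht

theorem SatisfiesC1.mass_pos (hd : 0 < d) (hg : SatisfiesC1 d p ζ V g) {r : ℝ}
    (hr : r ∈ intervalTo ζ 1) : 0 < ∫ y in wolffDomain d p ζ r, radialG p g ‖y‖ := by
  rw [setIntegral_wolffDomain hd p _ hr]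
  have := volume_unitBall_pos d
  have hd' : (0 : ℝ) < d := Nat.cast_pos.2 hd
  exact mul_pos (by positivity) (setIntegral_innerInterval_pos hr
    (fun s hs => mul_pos (hg.radialG_pos hs) (pow_pos hs _)) (hg.c1.inner_integrable r hr))

theorem SatisfiesC1.integrableOn_wolff (hd : 0 < d) (hg : SatisfiesC1 d p ζ V g) :
    IntegrableOn (fun t => t ^ alphaStar d p *
      (∫ y in wolffDomain d p ζ t, radialG p g ‖y‖) ^ (1 / (p - 1)) / t) (intervalTo ζ 1) := by
  refine IntegrableOn.congr_fun (Integrable.const_mul hg.c1.outer_integrable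
    ((d * (volume (Metric.ball (0 : E d) 1)).toReal) ^ (1 / (p - 1)))) ?_
    (isOpen_intervalTo ζ 1).measurableSet
  intro t ht
  have hI := setIntegral_innerInterval_pos ht
    (fun s hs => mul_pos (hg.radialG_pos hs) (pow_pos hs _)) (hg.c1.inner_integrable t ht)
  have := volume_unitBall_pos d
  simp only []
  rw [setIntegral_wolffDomain hd p _ ht, Real.mul_rpow (by positivity) hI.le]
  ring

theorem SatisfiesC1.continuousOn_wolffIntegrand (hd : 0 < d) (hg : SatisfiesC1 d p ζ V g) :
    ContinuousOn (fun t => t ^ alphaStar d p *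
      (∫ y in wolffDomain d p ζ t, radialG p g ‖y‖) ^ (1 / (p - 1)) / t) (intervalTo ζ 1) := by
  intro t ht
  have ht0 : t ≠ 0 := (intervalTo_subset_pos ζ zero_le_one ht).ne'
  exact (((continuousAt_id.rpow_const (Or.inl ht0)).mul
    ((hg.hasDerivAt_mass hd ht).continuousAt.rpow_const (Or.inl (hg.mass_pos hd ht).ne'))).div
      continuousAt_id ht0).continuousWithinAt

theorem SatisfiesC1.hasDerivAt_wolff (hd : 0 < d) (hg : SatisfiesC1 d p ζ V g) {r : ℝ}
    (hr : r ∈ intervalTo ζ 1) : HasDerivAt (wolff d p ζ g) (wolffDeriv d p ζ g r) r := by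
  refine ((hasDerivAt_setIntegral_intervalTo (isOpen_intervalTo ζ 1) hr hr
    (hg.continuousOn_wolffIntegrand hd) (hg.integrableOn_wolff hd)).const_mul
      (1 / (volume (Metric.ball (0 : E d) 1)).toReal)).congr_deriv ?_
  rw [wolffDeriv]
  ring

theorem SatisfiesC1.radialSign_mul_wolffDeriv_pos (hd : 0 < d) (hg : SatisfiesC1 d p ζ V g)
    {r : ℝ} (hr : r ∈ intervalTo ζ 1) : 0 < radialSign ζ * wolffDeriv d p ζ g r := by
  have hr0 : 0 < r := intervalTo_subset_pos ζ zero_le_one hr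
  have h1 := volume_unitBall_pos d
  have h2 := Real.rpow_pos_of_pos (hg.mass_pos hd hr) (1 / (p - 1))
  rw [wolffDeriv, ← mul_assoc, radialSign_mul_self, one_mul]
  positivity

theorem SatisfiesC1.flux_eq (hd : 0 < d) (hp : 1 < p) (hg : SatisfiesC1 d p ζ V g)
    {r : ℝ} (hr : r ∈ intervalTo ζ 1) :
    |wolffDeriv d p ζ g r| ^ (p - 2) * wolffDeriv d p ζ g r * r ^ (d - 1) =
      radialSign ζ * (1 / (volume (Metric.ball (0 : E d) 1)).toReal) ^ (p - 1) *
        ∫ y in wolffDomain d p ζ r, radialG p g ‖y‖ := by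
  have hr0 : 0 < r := intervalTo_subset_pos ζ zero_le_one hr
  have hb := volume_unitBall_pos d
  have hm := hg.mass_pos hd hr
  have hpos := hg.radialSign_mul_wolffDeriv_pos hd hr
  have hp1 : p - 1 ≠ 0 := by linarith
  set I := ∫ y in wolffDomain d p ζ r, radialG p g ‖y‖ with hI
  set c := 1 / (volume (Metric.ball (0 : E d) 1)).toReal with hc
  set m := radialSign ζ * wolffDeriv d p ζ g r with hmdef
  have hc0 : 0 < c := by positivity
  have hmd : wolffDeriv d p ζ g r = radialSign ζ * m := by
    rw [hmdef, ← mul_assoc, radialSign_mul_self, one_mul]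
  have habs : |wolffDeriv d p ζ g r| = m := by
    rw [hmd, abs_mul, abs_of_pos hpos]
    cases ζ <;> simp [radialSign]
  have hmval : m = c * (r ^ (alphaStar d p - 1) * I ^ (1 / (p - 1))) := by
    rw [hmdef, wolffDeriv, ← mul_assoc, radialSign_mul_self, one_mul, Real.rpow_sub_one hr0.ne']
    ring
  have hpow : m ^ (p - 1) * r ^ (d - 1) = c ^ (p - 1) * I := by
    rw [hmval, Real.mul_rpow hc0.le (by positivity), Real.mul_rpow (by positivity) (by positivity),
      ← Real.rpow_mul hr0.le, ← Real.rpow_mul hm.le, one_div_mul_cancel hp1, Real.rpow_one,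
      ← Real.rpow_natCast r (d - 1)]
    -- This is what the exponent `α*` is made for: the powers of `r` cancel and only the mass
    -- remains in the flux.
    have he : (alphaStar d p - 1) * (p - 1) = -((d - 1 : ℕ) : ℝ) := by
      rw [Nat.cast_sub (by omega), alphaStar]
      field_simp
      push_cast
      ring
    rw [he, Real.rpow_neg hr0.le]
    have : r ^ ((d - 1 : ℕ) : ℝ) ≠ 0 := (Real.rpow_pos_of_pos hr0 _).ne'
    field_simp
  have hm2 : m ^ (p - 2) * m = m ^ (p - 1) := by
    rw [← Real.rpow_add_one hpos.ne']; congr 1; ring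
  rw [habs, hmd, mul_assoc (radialSign ζ), ← hpow, ← hm2]
  ring

/-- The Wolff potential solves `Δ_p W = ± k G`, with the sign of the case. -/
theorem SatisfiesC1.isProfile (hd : 0 < d) (hp : 1 < p) (hg : SatisfiesC1 d p ζ V g) :
    IsProfile d p (intervalTo ζ 1) (radialG p g) (wolff d p ζ g) (wolffDeriv d p ζ g)
      (classicalSign d p ζ) (wolffConst d p) where
  isOpen := isOpen_intervalTo ζ 1
  subset_pos := intervalTo_subset_pos ζ zero_le_one
  hasDerivAt _ hr := hg.hasDerivAt_wolff hd hr
  continuousOn_deriv :=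
    continuousOn_const.mul (continuousOn_const.mul (hg.continuousOn_wolffIntegrand hd))
  flux r hr := by
    have h := (hg.hasDerivAt_mass hd hr).const_mul
      (radialSign ζ * (1 / (volume (Metric.ball (0 : E d) 1)).toReal) ^ (p - 1))
    refine (h.congr_of_eventuallyEq ?_).congr_deriv ?_
    · filter_upwards [(isOpen_intervalTo ζ 1).mem_nhds hr] with t ht
      exact hg.flux_eq hd hp ht
    · rw [wolffConst]
      -- The sign of `W'` and the one in the derivative of the mass multiply to `radialSign ζ ^ 2 =
      -- 1`, leaving only the classical sign.
      linear_combination (1 / (volume (Metric.ball (0 : E d) 1)).toReal) ^ (p - 1) *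
        (d * (volume (Metric.ball (0 : E d) 1)).toReal *
        (classicalSign d p ζ * (radialG p g r * r ^ (d - 1)))) * radialSign_mul_self ζ
  continuousOn := hg.continuousOn_radialG.mono (intervalTo_subset_pos ζ zero_le_one)
  pos _ hr := hg.radialG_pos (intervalTo_subset_pos ζ zero_le_one hr)
  abs_sign := abs_classicalSign d p ζ
  const_pos := wolffConst_pos hd p

theorem SatisfiesC1.tendsto_wolff (hd : 0 < d) (hg : SatisfiesC1 d p ζ V g) :
    Tendsto (wolff d p ζ g) (radiusNhds ζ) (𝓝 0) := by
  have h := (tendsto_setIntegral_intervalTo one_pos (hg.integrableOn_wolff hd)).const_mul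
    (1 / (volume (Metric.ball (0 : E d) 1)).toReal)
  rwa [mul_zero] at h

theorem SatisfiesC1.wolff_lt_wolff (hd : 0 < d) (hg : SatisfiesC1 d p ζ V g) {r s : ℝ}
    (hr : r ∈ intervalTo ζ 1) (hs : s ∈ intervalTo ζ 1) (hrs : Closer ζ r s) :
    wolff d p ζ g r < wolff d p ζ g s := by
  have hc : ContinuousOn (wolff d p ζ g) (intervalTo ζ 1) := fun t ht =>
    (hg.hasDerivAt_wolff hd ht).continuousAt.continuousWithinAt
  have hder : ∀ t ∈ intervalTo ζ 1, 0 < radialSign ζ * deriv (wolff d p ζ g) t := fun t ht => by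
    rw [(hg.hasDerivAt_wolff hd ht).deriv]
    exact hg.radialSign_mul_wolffDeriv_pos hd ht
  cases ζ
  · refine strictMonoOn_of_deriv_pos (convex_Ioo 0 1) hc (fun t ht => ?_) hr hs hrs
    rw [interior_Ioo] at ht
    simpa [radialSign] using hder t ht
  · refine strictAntiOn_of_deriv_neg (convex_Ioi 1) hc (fun t ht => ?_) hs hr hrs
    rw [interior_Ioi] at ht
    simpa [radialSign] using hder t ht

theorem SatisfiesC1.wolff_nonneg (hd : 0 < d) (hg : SatisfiesC1 d p ζ V g) {r : ℝ}
    (hr : r ∈ intervalTo ζ 1) : 0 ≤ wolff d p ζ g r := by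
  refine mul_nonneg (by positivity) (setIntegral_nonneg (isOpen_intervalTo ζ r).measurableSet
    fun t ht => ?_)
  have ht1 := intervalTo_subset ζ hr ht
  have ht0 : 0 < t := intervalTo_subset_pos ζ zero_le_one ht1
  have := Real.rpow_pos_of_pos (hg.mass_pos hd ht1) (1 / (p - 1))
  positivity

end Wolff

/-! ### Radii tending to `ζ`, and monotonicity near `ζ`. -/

theorem mem_puncturedNhd {d : ℕ} {ζ : SingularPoint} {ρ : ℝ} {x : E d} :
    x ∈ puncturedNhd d ζ ρ ↔ ‖x‖ ∈ intervalTo ζ ρ := by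
  cases ζ
  · simp [puncturedNhd, intervalTo, and_comm]
  · simp [puncturedNhd, intervalTo]

theorem isOpen_puncturedNhd (d : ℕ) (ζ : SingularPoint) (ρ : ℝ) :
    IsOpen (puncturedNhd d ζ ρ) := by
  have : puncturedNhd d ζ ρ = {x | ‖x‖ ∈ intervalTo ζ ρ} := ext fun _ => mem_puncturedNhd
  rw [this]
  exact (isOpen_intervalTo ζ ρ).preimage continuous_norm

theorem comap_norm_radiusNhds (d : ℕ) (ζ : SingularPoint) :
    comap norm (radiusNhds ζ) = nhdsSing d ζ := by
  cases ζ
  · exact comap_norm_nhdsGT_zero _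
  · exact comap_norm_atTop

instance (ζ : SingularPoint) : (radiusNhds ζ).NeBot := by
  cases ζ <;> simp only [radiusNhds] <;> infer_instance

theorem intervalTo_mem_radiusNhds (ζ : SingularPoint) {ρ : ℝ} (hρ : 0 < ρ) :
    intervalTo ζ ρ ∈ radiusNhds ζ := by
  cases ζ
  · exact Ioo_mem_nhdsGT hρ
  · exact Ioi_mem_atTop ρ

theorem eventually_closer (ζ : SingularPoint) {r : ℝ} (hr : 0 < r) :
    ∀ᶠ s in radiusNhds ζ, Closer ζ s r := by
  filter_upwards [intervalTo_mem_radiusNhds ζ hr] with s hs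
  cases ζ
  · exact hs.2
  · exact hs

theorem exists_intervalTo_subset {ζ : SingularPoint} {ρ : ℝ} (hρ : 0 < ρ) {S : Set ℝ}
    (hS : S ∈ radiusNhds ζ) : ∃ δ ∈ intervalTo ζ ρ, intervalTo ζ δ ⊆ S := by
  cases ζ
  · obtain ⟨ε, hε, hεS⟩ := mem_nhdsGT_iff_exists_Ioo_subset.1 hS
    have hε : 0 < ε := hε
    have hm := lt_min hε hρ
    have h1 := min_le_left ε ρ
    have h2 := min_le_right ε ρ
    refine ⟨min ε ρ / 2, ⟨by linarith, by linarith⟩, fun x hx => hεS ⟨hx.1, ?_⟩⟩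
    linarith [hx.2]
  · obtain ⟨c, hc⟩ := mem_atTop_sets.1 hS
    have h1 := le_max_left c ρ
    have h2 := le_max_right c ρ
    refine ⟨max c ρ + 1, mem_Ioi.2 (by linarith), fun x hx => hc x ?_⟩
    have : max c ρ + 1 < x := hx
    linarith

theorem ordConnected_intervalTo (ζ : SingularPoint) (ρ : ℝ) : (intervalTo ζ ρ).OrdConnected := by
  cases ζ
  · exact ordConnected_Ioo
  · exact ordConnected_Ioi

/-- Nested `∀ᶠ` encodes the dependence of `R₁` on `r₂`; `min` and `max` treat the two orderings of
`r₁`, `r₂` at once. -/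
theorem forSpheresNear_of_eventually {ζ : SingularPoint} {ρ : ℝ} (hρ : 0 < ρ)
    {P : ℝ → ℝ → ℝ → Prop}
    (h : ∀ᶠ r₂ in radiusNhds ζ, ∀ᶠ r₁ in radiusNhds ζ,
      ∀ r₃ ∈ Ioo (min r₁ r₂) (max r₁ r₂), P r₁ r₂ r₃) : ForSpheresNear ρ P ζ := by
  obtain ⟨R₂, hR₂, hsub⟩ := exists_intervalTo_subset hρ h
  cases ζ
  · refine ⟨R₂, hR₂.1, hR₂.2.le, fun r₂ h0 hr₂ => ?_⟩
    have h2 : ∀ᶠ r₁ in radiusNhds .zero, ∀ r₃ ∈ Ioo (min r₁ r₂) (max r₁ r₂), P r₁ r₂ r₃ :=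
      hsub ⟨h0, hr₂⟩
    obtain ⟨R₁, hR₁, hsub₁⟩ := exists_intervalTo_subset h0 h2
    refine ⟨R₁, hR₁.1, hR₁.2, fun r₁ h1 hr₁ r₃ hr₃ => hsub₁ ⟨h1, hr₁⟩ r₃ ?_⟩
    have := (hr₁.trans hR₁.2).le
    rwa [min_eq_left this, max_eq_right this]
  · have hR₂' : ρ < R₂ := hR₂
    refine ⟨R₂, hρ.trans hR₂', hR₂'.le, fun r₂ hr₂ => ?_⟩
    have h2 : ∀ᶠ r₁ in radiusNhds .infty, ∀ r₃ ∈ Ioo (min r₁ r₂) (max r₁ r₂), P r₁ r₂ r₃ :=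
      hsub (mem_Ioi.2 hr₂)
    obtain ⟨R₁, hR₁, hsub₁⟩ := exists_intervalTo_subset (hρ.trans (hR₂'.trans hr₂)) h2
    have hR₁' : r₂ < R₁ := hR₁
    refine ⟨R₁, hR₁', fun r₁ hr₁ r₃ hr₃ => hsub₁ (mem_Ioi.2 hr₁) r₃ ?_⟩
    have := (hR₁'.trans hr₁).le
    rwa [min_eq_right this, max_eq_left this]

theorem monotoneNear_of_closer {ζ : SingularPoint} {ρ δ : ℝ} (hρ : 0 < ρ)
    (hδ : δ ∈ intervalTo ζ ρ) {F : ℝ → ℝ}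
    (h : (∀ a ∈ intervalTo ζ δ, ∀ b ∈ intervalTo ζ δ, Closer ζ a b → F a ≤ F b) ∨
      (∀ a ∈ intervalTo ζ δ, ∀ b ∈ intervalTo ζ δ, Closer ζ a b → F b ≤ F a)) :
    MonotoneNear ρ F ζ := by
  cases ζ
  · refine ⟨δ, hδ.1, hδ.2.le, h.imp (fun h a ha b hb hab => ?_) (fun h a ha b hb hab => ?_)⟩
    all_goals
      rcases hab.eq_or_lt with rfl | hlt
      · exact le_rfl
      · exact h a ha b hb hlt
  · have hδ' : ρ < δ := hδ
    refine ⟨δ, hρ.trans hδ', hδ'.le,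
      h.symm.imp (fun h a ha b hb hab => ?_) (fun h a ha b hb hab => ?_)⟩
    all_goals
      rcases hab.eq_or_lt with rfl | hlt
      · exact le_rfl
      · exact h b hb a ha hlt

theorem MonotoneNear.of_neg {ζ : SingularPoint} {ρ : ℝ} {F : ℝ → ℝ}
    (h : MonotoneNear ρ (fun r => -F r) ζ) : MonotoneNear ρ F ζ := by
  cases ζ <;> obtain ⟨δ, h0, h1, h2⟩ := h <;> refine ⟨δ, h0, h1, h2.symm.imp ?_ ?_⟩ <;>
    exact fun h a ha b hb hab => neg_le_neg_iff.1 (h ha hb hab)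

theorem Closer.mem_Ioo {ζ : SingularPoint} {a b c : ℝ} (hab : Closer ζ a b) (hbc : Closer ζ b c) :
    b ∈ Ioo (min a c) (max a c) := by
  cases ζ
  · exact ⟨min_lt_of_left_lt hab, lt_max_of_lt_right hbc⟩
  · exact ⟨min_lt_of_right_lt hbc, lt_max_of_lt_left hab⟩

/-- A function that satisfies the maximum principle near `ζ` and eventually lies below
(or above) its previous values is monotone near `ζ`. -/
theorem monotoneNear_of_le_max {ζ : SingularPoint} {ρ : ℝ} (hρ : 0 < ρ) {F : ℝ → ℝ}
    (h : ∀ᶠ r₂ in radiusNhds ζ, ∀ᶠ r₁ in radiusNhds ζ,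
      ∀ r₃ ∈ Ioo (min r₁ r₂) (max r₁ r₂), F r₃ ≤ max (F r₁) (F r₂))
    (hlim : (∀ᶠ r₂ in radiusNhds ζ, ∀ᶠ r₁ in radiusNhds ζ, F r₁ < F r₂) ∨
      (∀ᶠ r₂ in radiusNhds ζ, ∀ᶠ r₁ in radiusNhds ζ, F r₂ < F r₁)) :
    MonotoneNear ρ F ζ := by
  rcases hlim with hlim | hlim
  · obtain ⟨δ, hδ, hsub⟩ := exists_intervalTo_subset hρ (h.and hlim)
    refine monotoneNear_of_closer hρ hδ (Or.inl fun a ha b hb hab => ?_)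
    obtain ⟨h1, h2⟩ := hsub hb
    have ha0 : 0 < a := intervalTo_subset_pos ζ (intervalTo_subset_pos ζ hρ.le hδ).le ha
    -- An auxiliary radius `r` beyond `a` towards `ζ`, with `F r < F b`, makes the maximum over the
    -- outer pair equal to `F b`.
    obtain ⟨r, hr1, hr2, hr3⟩ := (h1.and (h2.and (eventually_closer ζ ha0))).exists
    have := hr1 a (hr3.mem_Ioo hab)
    rwa [max_eq_right hr2.le] at this
  -- Here one outer radius `r₂` is fixed for good. Closer to `ζ` every value exceeds `F r₂`, so in
  -- the maximum principle on `(a, r₂)` only `F a` can bound `F b`.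
  · obtain ⟨r₂, ⟨h1, h2⟩, hr0⟩ :=
      ((h.and hlim).and (intervalTo_mem_radiusNhds ζ one_pos)).exists
    have hr0' : 0 < r₂ := intervalTo_subset_pos ζ zero_le_one hr0
    obtain ⟨δ, hδ, hsub⟩ := exists_intervalTo_subset hρ
      (h1.and (h2.and (eventually_closer ζ hr0')))
    refine monotoneNear_of_closer hρ hδ (Or.inr fun a ha b hb hab => ?_)
    have hb2 := (hsub hb).2
    have := (hsub ha).1 b (hab.mem_Ioo hb2.2)
    rcases le_max_iff.1 this with h | h
    · exact h
    · exact absurd hb2.1 h.not_gt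

/-! ### Limits of the extrema on spheres, and the slope of the interpolant. -/

/-- `F → 0` if `s = 1`, and `F → ∞` if `s = -1`. -/
def SignedLimit {α : Type*} (s : ℝ) (F : α → ℝ) (l : Filter α) : Prop :=
  (s = 1 ∧ Tendsto F l (𝓝 0)) ∨ (s = -1 ∧ Tendsto F l atTop)

/-- The sign `-θ` is the one `SignedLimit.slope` transfers to the slope, giving `θ B < 0`. -/
theorem SubLimit.signedLimit {d : ℕ} {p : ℝ} {u : E d → ℝ} {ζ : SingularPoint}
    (h : SubLimit d p u ζ) : SignedLimit (-classicalSign d p ζ) u (nhdsSing d ζ) := by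
  cases ζ <;> simp only [classicalSign] <;> split_ifs with hpd
  · exact Or.inr ⟨rfl, h.2 hpd⟩
  · exact Or.inl ⟨neg_neg 1, h.1 (not_le.1 hpd)⟩
  · exact Or.inr ⟨rfl, h.1 hpd⟩
  · exact Or.inl ⟨neg_neg 1, h.2 (not_le.1 hpd)⟩

theorem SuperLimit.signedLimit {d : ℕ} {p : ℝ} {u : E d → ℝ} {ζ : SingularPoint}
    (h : SuperLimit d p u ζ) : SignedLimit (classicalSign d p ζ) u (nhdsSing d ζ) := by
  cases ζ <;> simp only [classicalSign] <;> split_ifs with hpd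
  · exact Or.inl ⟨rfl, h.2 hpd⟩
  · exact Or.inr ⟨rfl, h.1 (not_le.1 hpd)⟩
  · exact Or.inl ⟨rfl, h.1 hpd⟩
  · exact Or.inr ⟨rfl, h.2 (not_le.1 hpd)⟩

/-- The maximum and the minimum on a sphere are values of `u` there, so both inherit its limit at
`ζ`. -/
theorem tendsto_radial {d : ℕ} {ζ : SingularPoint} {u : E d → ℝ} {F : ℝ → ℝ} {l : Filter ℝ}
    (hF : ∀ᶠ r in radiusNhds ζ, ∃ x : E d, ‖x‖ = r ∧ F r = u x)
    (h : Tendsto u (nhdsSing d ζ) l) : Tendsto F (radiusNhds ζ) l := by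
  intro S hS
  have h1 := h hS
  rw [← comap_norm_radiusNhds] at h1
  obtain ⟨T, hT, hTS⟩ := h1
  rw [mem_map]
  filter_upwards [hF, hT] with r hr hrT
  obtain ⟨x, rfl, hx⟩ := hr
  rw [mem_preimage, hx]
  exact hTS hrT

theorem SignedLimit.radial {d : ℕ} {ζ : SingularPoint} {u : E d → ℝ} {F : ℝ → ℝ} {s : ℝ}
    (hF : ∀ᶠ r in radiusNhds ζ, ∃ x : E d, ‖x‖ = r ∧ F r = u x)
    (h : SignedLimit s u (nhdsSing d ζ)) : SignedLimit s F (radiusNhds ζ) :=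
  h.imp (fun h => ⟨h.1, tendsto_radial hF h.2⟩) (fun h => ⟨h.1, tendsto_radial hF h.2⟩)

theorem sphere_nonempty {d : ℕ} (hd : 0 < d) {r : ℝ} (hr : 0 < r) :
    (Metric.sphere (0 : E d) r).Nonempty := by
  have : Nonempty (Fin d) := ⟨⟨0, hd⟩⟩
  exact NormedSpace.sphere_nonempty.2 hr.le

theorem exists_sphereSup {d : ℕ} (hd : 0 < d) {r : ℝ} (hr : 0 < r) {u : E d → ℝ}
    (hu : ContinuousOn u (Metric.sphere 0 r)) :
    (∃ x : E d, ‖x‖ = r ∧ sphereSup u r = u x) ∧ ∀ y : E d, ‖y‖ = r → u y ≤ sphereSup u r := by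
  obtain ⟨x, hx, h1, h2⟩ :=
    (isCompact_sphere (0 : E d) r).exists_sSup_image_eq_and_ge (sphere_nonempty hd hr) hu
  exact ⟨⟨x, mem_sphere_zero_iff_norm.1 hx, h1⟩, fun y hy =>
    (h2 y (mem_sphere_zero_iff_norm.2 hy)).trans h1.ge⟩

theorem exists_sphereInf {d : ℕ} (hd : 0 < d) {r : ℝ} (hr : 0 < r) {u : E d → ℝ}
    (hu : ContinuousOn u (Metric.sphere 0 r)) :
    (∃ x : E d, ‖x‖ = r ∧ sphereInf u r = u x) ∧ ∀ y : E d, ‖y‖ = r → sphereInf u r ≤ u y := by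
  obtain ⟨x, hx, h1, h2⟩ :=
    (isCompact_sphere (0 : E d) r).exists_sInf_image_eq_and_le (sphere_nonempty hd hr) hu
  exact ⟨⟨x, mem_sphere_zero_iff_norm.1 hx, h1⟩, fun y hy =>
    h1.le.trans (h2 y (mem_sphere_zero_iff_norm.2 hy))⟩

theorem interp_eq {F W : ℝ → ℝ} {r₁ r₂ : ℝ} (hW : W r₁ < W r₂) (r : ℝ) :
    interp F W r₁ r₂ r = (F r₁ - (F r₂ - F r₁) / (W r₂ - W r₁) * W r₁) +
      (F r₂ - F r₁) / (W r₂ - W r₁) * W r := by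
  have : W r₂ - W r₁ ≠ 0 := (sub_pos.2 hW).ne'
  rw [interp]
  field_simp
  ring

theorem interp_left {F W : ℝ → ℝ} {r₁ r₂ : ℝ} (hW : W r₁ < W r₂) :
    interp F W r₁ r₂ r₁ = F r₁ := by
  rw [interp_eq hW]; ring

theorem interp_right {F W : ℝ → ℝ} {r₁ r₂ : ℝ} (hW : W r₁ < W r₂) :
    interp F W r₁ r₂ r₂ = F r₂ := by
  have : W r₂ - W r₁ ≠ 0 := (sub_pos.2 hW).ne'
  rw [interp, sub_self, zero_div, div_self this]; ring

theorem interp_mem_Icc {F W : ℝ → ℝ} {r₁ r₂ r : ℝ} (hW : W r₁ < W r₂) (h1 : W r₁ ≤ W r)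
    (h2 : W r ≤ W r₂) :
    interp F W r₁ r₂ r ∈ Icc (min (F r₁) (F r₂)) (max (F r₁) (F r₂)) := by
  have h : 0 < W r₂ - W r₁ := sub_pos.2 hW
  have hs : (W r₂ - W r) / (W r₂ - W r₁) + (W r - W r₁) / (W r₂ - W r₁) = 1 := by
    rw [← add_div, div_eq_one_iff_eq h.ne']; ring
  have ha : 0 ≤ (W r₂ - W r) / (W r₂ - W r₁) := div_nonneg (by linarith) h.le
  have hb : 0 ≤ (W r - W r₁) / (W r₂ - W r₁) := div_nonneg (by linarith) h.le
  rw [interp, mul_comm (F r₁), mul_comm (F r₂)]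
  exact ⟨Convex.min_le_combo _ _ ha hb hs, Convex.combo_le_max _ _ ha hb hs⟩

/-- Close to `ζ` the interpolating function has a large slope of the right sign. -/
theorem SignedLimit.slope {l : Filter ℝ} {F W : ℝ → ℝ} {s k p : ℝ} (hp : 1 < p) (hk : 0 < k)
    (hF : SignedLimit s F l) (hpos : ∀ᶠ r in l, 0 < F r) (hW : Tendsto W l (𝓝 0))
    (hW0 : ∀ᶠ r in l, 0 ≤ W r) :
    ∀ᶠ r₂ in l, ∀ᶠ r₁ in l, W r₁ < W r₂ → 0 < s * ((F r₂ - F r₁) / (W r₂ - W r₁)) ∧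
      max (F r₁) (F r₂) ^ (p - 1) < |(F r₂ - F r₁) / (W r₂ - W r₁)| ^ (p - 1) * k := by
  -- Taking `(p-1)`-th roots, the claim becomes `max < |slope| κ`. It follows from `max ≤ 2 |F₂ -
  -- F₁|` and `w₂ - w₁ < κ / 2`.
  set κ := k ^ (1 / (p - 1)) with hκ
  have hκ0 : 0 < κ := Real.rpow_pos_of_pos hk _
  have hκk : κ ^ (p - 1) = k := by
    rw [hκ, ← Real.rpow_mul hk.le, one_div_mul_cancel (by linarith), Real.rpow_one]
  have key : ∀ F₁ F₂ w₁ w₂ : ℝ, 0 < F₁ → 0 < F₂ → 0 ≤ w₁ → w₁ < w₂ → w₂ < κ / 2 →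
      max F₁ F₂ ≤ 2 * |F₂ - F₁| → max F₁ F₂ ^ (p - 1) < |(F₂ - F₁) / (w₂ - w₁)| ^ (p - 1) * k := by
    intro F₁ F₂ w₁ w₂ h1 h2 hw1 hw12 hw2 hmax
    have hd : 0 < w₂ - w₁ := sub_pos.2 hw12
    have hm : 0 < max F₁ F₂ := lt_max_of_lt_left h1
    have hlt : max F₁ F₂ < |(F₂ - F₁) / (w₂ - w₁)| * κ := by
      rw [abs_div, abs_of_pos hd, div_mul_eq_mul_div, lt_div_iff₀ hd]
      nlinarith
    have := Real.rpow_lt_rpow hm.le hlt (show 0 < p - 1 by linarith)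
    rwa [Real.mul_rpow (abs_nonneg _) hκ0.le, hκk] at this
  filter_upwards [hpos, hW.eventually_lt_const (half_pos hκ0)] with r₂ hF₂ hW₂
  -- With `r₂` fixed, `r₁` is taken so close to `ζ` that `F r₁ < F r₂ / 2` in the first case and `F
  -- r₁ > 2 F r₂` in the second. The increment then has the right sign and at least half the size of
  -- the larger value.
  rcases hF with ⟨rfl, hF⟩ | ⟨rfl, hF⟩
  · filter_upwards [hpos, hW0, hF.eventually_lt_const (half_pos hF₂)] with r₁ hF₁ hW₁ hlt hWlt
    have hd : 0 < F r₂ - F r₁ := by linarith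
    refine ⟨?_, key _ _ _ _ hF₁ hF₂ hW₁ hWlt hW₂ ?_⟩
    · rw [one_mul]
      exact div_pos hd (sub_pos.2 hWlt)
    · rw [abs_of_pos hd, max_eq_right (by linarith)]
      linarith
  · filter_upwards [hpos, hW0, hF.eventually_gt_atTop (2 * F r₂)] with r₁ hF₁ hW₁ hlt hWlt
    have hd : F r₂ - F r₁ < 0 := by linarith
    refine ⟨?_, key _ _ _ _ hF₁ hF₂ hW₁ hWlt hW₂ ?_⟩
    · have := div_neg_of_neg_of_pos hd (sub_pos.2 hWlt)
      linarith
    · rw [abs_of_neg hd, max_eq_left (by linarith)]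
      linarith

theorem SignedLimit.eventually_lt {l : Filter ℝ} {F : ℝ → ℝ} {s : ℝ} (hF : SignedLimit s F l)
    (hpos : ∀ᶠ r in l, 0 < F r) :
    (∀ᶠ r₂ in l, ∀ᶠ r₁ in l, F r₁ < F r₂) ∨ (∀ᶠ r₂ in l, ∀ᶠ r₁ in l, F r₂ < F r₁) := by
  rcases hF with ⟨-, hF⟩ | ⟨-, hF⟩
  · exact Or.inl (hpos.mono fun r hr => hF.eventually_lt_const hr)
  · exact Or.inr (Eventually.of_forall fun r => hF.eventually_gt_atTop _)

theorem wolff_mem_Icc {d : ℕ} (hd : 0 < d) {p : ℝ} {ζ : SingularPoint} {V : E d → ℝ} {g : ℝ → ℝ}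
    (hg : SatisfiesC1 d p ζ V g) {r₁ r₂ r : ℝ} (h1 : r₁ ∈ intervalTo ζ 1)
    (h2 : r₂ ∈ intervalTo ζ 1) (h12 : Closer ζ r₁ r₂) (hr : r ∈ Icc (min r₁ r₂) (max r₁ r₂)) :
    wolff d p ζ g r ∈ Icc (wolff d p ζ g r₁) (wolff d p ζ g r₂) := by
  have hr' : r ∈ intervalTo ζ 1 := (ordConnected_intervalTo ζ 1).uIcc_subset h1 h2 hr
  have key : ∀ a b, a ∈ intervalTo ζ 1 → b ∈ intervalTo ζ 1 → (a = b ∨ Closer ζ a b) →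
      wolff d p ζ g a ≤ wolff d p ζ g b := by
    rintro a b ha hb (rfl | h)
    · exact le_rfl
    · exact (hg.wolff_lt_wolff hd ha hb h).le
  cases ζ
  · have h12 : r₁ < r₂ := h12
    rw [min_eq_left h12.le, max_eq_right h12.le] at hr
    exact ⟨key _ _ h1 hr' hr.1.eq_or_lt, key _ _ hr' h2 hr.2.eq_or_lt⟩
  · have h12 : r₂ < r₁ := h12
    rw [min_eq_right h12.le, max_eq_left h12.le] at hr
    exact ⟨key _ _ h1 hr' (hr.2.eq_or_lt.imp Eq.symm id),
      key _ _ hr' h2 (hr.1.eq_or_lt.imp Eq.symm id)⟩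

/-! ### The three spheres inequalities and monotonicity. -/

section Main

variable {d : ℕ} {p : ℝ} {ζ : SingularPoint} {V u : E d → ℝ} {g : ℝ → ℝ} {ρ : ℝ}

/-- `|V| ≤ G` almost everywhere on annuli close to `ζ`. -/
theorem SatisfiesC1.eventually_dominated (hg : SatisfiesC1 d p ζ V g) :
    ∀ᶠ r₂ in radiusNhds ζ, ∀ᶠ r₁ in radiusNhds ζ,
      ∀ᵐ x : E d, ‖x‖ ∈ Ioo (min r₁ r₂) (max r₁ r₂) → |V x| ≤ radialG p g ‖x‖ := by
  obtain ⟨ρ', hρ', hdom⟩ := hg.dominates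
  rw [ae_restrict_iff' (isOpen_puncturedNhd d ζ ρ').measurableSet] at hdom
  have h := intervalTo_mem_radiusNhds ζ hρ'
  filter_upwards [h] with r₂ h2
  filter_upwards [h] with r₁ h1
  filter_upwards [hdom] with x hx hxA
  exact hx (mem_puncturedNhd.2
    ((ordConnected_intervalTo ζ ρ').uIcc_subset h1 h2 (Ioo_subset_Icc_self hxA)))

theorem continuousOn_sphere (hu : ContinuousOn u (puncturedNhd d ζ ρ)) {r : ℝ}
    (hr : r ∈ intervalTo ζ ρ) : ContinuousOn u (Metric.sphere 0 r) :=
  hu.mono fun x hx => mem_puncturedNhd.2 (by rwa [mem_sphere_zero_iff_norm.1 hx])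

theorem annulus_subset_puncturedNhd {r₁ r₂ : ℝ} (h1 : r₁ ∈ intervalTo ζ ρ)
    (h2 : r₂ ∈ intervalTo ζ ρ) :
    {x : E d | ‖x‖ ∈ Icc (min r₁ r₂) (max r₁ r₂)} ⊆ puncturedNhd d ζ ρ := fun _ hx =>
  mem_puncturedNhd.2 ((ordConnected_intervalTo ζ ρ).uIcc_subset h1 h2 hx)

theorem norm_eq_of_boundary {x : E d} {r₁ r₂ : ℝ} (h : ‖x‖ = min r₁ r₂ ∨ ‖x‖ = max r₁ r₂) :
    ‖x‖ = r₁ ∨ ‖x‖ = r₂ := by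
  rcases h with h | h
  · exact (min_choice r₁ r₂).imp h.trans h.trans
  · exact (max_choice r₁ r₂).imp h.trans h.trans

theorem IsSubsolution.eventually_le_interp (hd : 0 < d) (hp : 1 < p) (hg : SatisfiesC1 d p ζ V g)
    (hρ : 0 < ρ) (hV : LocBounded V (puncturedNhd d ζ ρ)) (hpos : ∀ x ∈ puncturedNhd d ζ ρ, 0 < u x)
    (hu : IsSubsolution p V (puncturedNhd d ζ ρ) u) (hlim : SubLimit d p u ζ) :
    (∀ᶠ r₂ in radiusNhds ζ, ∀ᶠ r₁ in radiusNhds ζ, ∀ r₃ ∈ Ioo (min r₁ r₂) (max r₁ r₂),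
      wolff d p ζ g r₁ < wolff d p ζ g r₂ ∧
      sphereSup u r₃ ≤ interp (sphereSup u) (wolff d p ζ g) r₁ r₂ r₃) ∧
    MonotoneNear ρ (sphereSup u) ζ := by
  have hρm := intervalTo_mem_radiusNhds ζ hρ
  have h1m := intervalTo_mem_radiusNhds ζ one_pos
  have hsup : ∀ r ∈ intervalTo ζ ρ, _ := fun r hr => exists_sphereSup hd
    (intervalTo_subset_pos ζ hρ.le hr) (continuousOn_sphere hu.1.continuousOn hr)
  have hMpos : ∀ r ∈ intervalTo ζ ρ, 0 < sphereSup u r := by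
    intro r hr
    obtain ⟨x, rfl, hx⟩ := (hsup r hr).1
    rw [hx]
    exact hpos x (mem_puncturedNhd.2 hr)
  have hMpos' : ∀ᶠ r in radiusNhds ζ, 0 < sphereSup u r := by
    filter_upwards [hρm] with r hr using hMpos r hr
  have hM : SignedLimit (-classicalSign d p ζ) (sphereSup u) (radiusNhds ζ) :=
    hlim.signedLimit.radial (by filter_upwards [hρm] with r hr using (hsup r hr).1)
  have hW0 : ∀ᶠ r in radiusNhds ζ, 0 ≤ wolff d p ζ g r := by
    filter_upwards [h1m] with r hr using hg.wolff_nonneg hd hr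
  have hprof := hg.isProfile hd hp
  have hmain : ∀ᶠ r₂ in radiusNhds ζ, ∀ᶠ r₁ in radiusNhds ζ,
      ∀ r₃ ∈ Ioo (min r₁ r₂) (max r₁ r₂), wolff d p ζ g r₁ < wolff d p ζ g r₂ ∧
      sphereSup u r₃ ≤ interp (sphereSup u) (wolff d p ζ g) r₁ r₂ r₃ ∧
      interp (sphereSup u) (wolff d p ζ g) r₁ r₂ r₃ ≤ max (sphereSup u r₁) (sphereSup u r₂) := by
    filter_upwards [hρm, h1m, hg.eventually_dominated,
      hM.slope hp hprof.const_pos hMpos' (hg.tendsto_wolff hd) hW0] with r₂ h2ρ h21 h2d h2s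
    filter_upwards [hρm, h1m, h2d, h2s,
      eventually_closer ζ (intervalTo_subset_pos ζ hρ.le h2ρ)] with r₁ h1ρ h11 h1d h1s h12 r₃ hr₃
    have hWlt := hg.wolff_lt_wolff hd h11 h21 h12
    obtain ⟨hs1, hs2⟩ := h1s hWlt
    have hIcc : ∀ r ∈ Icc (min r₁ r₂) (max r₁ r₂),
        interp (sphereSup u) (wolff d p ζ g) r₁ r₂ r ∈ Icc _ _ := fun r hr =>
      interp_mem_Icc hWlt (wolff_mem_Icc hd hg h11 h21 h12 hr).1
        (wolff_mem_Icc hd hg h11 h21 h12 hr).2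
    refine ⟨hWlt, ?_, (hIcc r₃ (Ioo_subset_Icc_self hr₃)).2⟩
    have hr₃ρ : r₃ ∈ intervalTo ζ ρ :=
      (ordConnected_intervalTo ζ ρ).uIcc_subset h1ρ h2ρ (Ioo_subset_Icc_self hr₃)
    -- The supremum is attained, so it suffices to compare `u` with the interpolant at one point.
    -- The maximum of the end values serves as `N`.
    obtain ⟨x, rfl, hx⟩ := (hsup r₃ hr₃ρ).1
    rw [hx, interp_eq hWlt]
    refine hu.le_of_boundary hd hp hprof (isOpen_puncturedNhd d ζ ρ) hV hpos
      ((ordConnected_intervalTo ζ 1).uIcc_subset h11 h21) (annulus_subset_puncturedNhd h1ρ h2ρ) h1d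
      (by linarith) (fun r hr => ?_) (fun r hr => ?_) hs2 (fun y hy => ?_) hr₃
    · rw [← interp_eq hWlt]
      exact (hIcc r hr).2
    · rw [← interp_eq hWlt]
      exact (lt_min (hMpos r₁ h1ρ) (hMpos r₂ h2ρ)).trans_le (hIcc r hr).1
    · rw [← interp_eq hWlt]
      rcases norm_eq_of_boundary hy with h | h
      · rw [h, interp_left hWlt]
        exact (hsup r₁ h1ρ).2 y h
      · rw [h, interp_right hWlt]
        exact (hsup r₂ h2ρ).2 y h
  refine ⟨hmain.mono fun r₂ h => h.mono fun r₁ h r₃ hr₃ => ⟨(h r₃ hr₃).1, (h r₃ hr₃).2.1⟩,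
    monotoneNear_of_le_max hρ (hmain.mono fun r₂ h => h.mono fun r₁ h r₃ hr₃ =>
      (h r₃ hr₃).2.1.trans (h r₃ hr₃).2.2) (hM.eventually_lt hMpos')⟩

theorem IsSupersolution.eventually_interp_le (hd : 0 < d) (hp : 1 < p)
    (hg : SatisfiesC1 d p ζ V g)
    (hρ : 0 < ρ) (hV : LocBounded V (puncturedNhd d ζ ρ)) (hpos : ∀ x ∈ puncturedNhd d ζ ρ, 0 < u x)
    (hu : IsSupersolution p V (puncturedNhd d ζ ρ) u) (hlim : SuperLimit d p u ζ) :
    (∀ᶠ r₂ in radiusNhds ζ, ∀ᶠ r₁ in radiusNhds ζ, ∀ r₃ ∈ Ioo (min r₁ r₂) (max r₁ r₂),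
      wolff d p ζ g r₁ < wolff d p ζ g r₂ ∧
      interp (sphereInf u) (wolff d p ζ g) r₁ r₂ r₃ ≤ sphereInf u r₃) ∧
    MonotoneNear ρ (sphereInf u) ζ := by
  have hρm := intervalTo_mem_radiusNhds ζ hρ
  have h1m := intervalTo_mem_radiusNhds ζ one_pos
  have hinf : ∀ r ∈ intervalTo ζ ρ, _ := fun r hr => exists_sphereInf hd
    (intervalTo_subset_pos ζ hρ.le hr) (continuousOn_sphere hu.1.continuousOn hr)
  have hmpos' : ∀ᶠ r in radiusNhds ζ, 0 < sphereInf u r := by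
    filter_upwards [hρm] with r hr
    obtain ⟨x, rfl, hx⟩ := (hinf r hr).1
    rw [hx]
    exact hpos x (mem_puncturedNhd.2 hr)
  have hm : SignedLimit (classicalSign d p ζ) (sphereInf u) (radiusNhds ζ) :=
    hlim.signedLimit.radial (by filter_upwards [hρm] with r hr using (hinf r hr).1)
  have hW0 : ∀ᶠ r in radiusNhds ζ, 0 ≤ wolff d p ζ g r := by
    filter_upwards [h1m] with r hr using hg.wolff_nonneg hd hr
  have hprof := hg.isProfile hd hp
  have hmain : ∀ᶠ r₂ in radiusNhds ζ, ∀ᶠ r₁ in radiusNhds ζ,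
      ∀ r₃ ∈ Ioo (min r₁ r₂) (max r₁ r₂), wolff d p ζ g r₁ < wolff d p ζ g r₂ ∧
      interp (sphereInf u) (wolff d p ζ g) r₁ r₂ r₃ ≤ sphereInf u r₃ ∧
      min (sphereInf u r₁) (sphereInf u r₂) ≤ interp (sphereInf u) (wolff d p ζ g) r₁ r₂ r₃ := by
    filter_upwards [hρm, h1m, hg.eventually_dominated,
      hm.slope hp hprof.const_pos hmpos' (hg.tendsto_wolff hd) hW0] with r₂ h2ρ h21 h2d h2s
    filter_upwards [hρm, h1m, h2d, h2s,
      eventually_closer ζ (intervalTo_subset_pos ζ hρ.le h2ρ)] with r₁ h1ρ h11 h1d h1s h12 r₃ hr₃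
    have hWlt := hg.wolff_lt_wolff hd h11 h21 h12
    obtain ⟨hs1, hs2⟩ := h1s hWlt
    have hIcc : ∀ r ∈ Icc (min r₁ r₂) (max r₁ r₂),
        interp (sphereInf u) (wolff d p ζ g) r₁ r₂ r ∈ Icc _ _ := fun r hr =>
      interp_mem_Icc hWlt (wolff_mem_Icc hd hg h11 h21 h12 hr).1
        (wolff_mem_Icc hd hg h11 h21 h12 hr).2
    refine ⟨hWlt, ?_, (hIcc r₃ (Ioo_subset_Icc_self hr₃)).1⟩
    have hr₃ρ : r₃ ∈ intervalTo ζ ρ :=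
      (ordConnected_intervalTo ζ ρ).uIcc_subset h1ρ h2ρ (Ioo_subset_Icc_self hr₃)
    obtain ⟨x, rfl, hx⟩ := (hinf r₃ hr₃ρ).1
    rw [hx, interp_eq hWlt]
    refine hu.le_of_boundary hd hp hprof (isOpen_puncturedNhd d ζ ρ) hV hpos
      ((ordConnected_intervalTo ζ 1).uIcc_subset h11 h21) (annulus_subset_puncturedNhd h1ρ h2ρ) h1d
      hs1 (fun r hr => ?_) hs2 (fun y hy => ?_) hr₃
    · rw [← interp_eq hWlt]
      exact (hIcc r hr).2
    · rw [← interp_eq hWlt]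
      rcases norm_eq_of_boundary hy with h | h
      · rw [h, interp_left hWlt]
        exact (hinf r₁ h1ρ).2 y h
      · rw [h, interp_right hWlt]
        exact (hinf r₂ h2ρ).2 y h
  refine ⟨hmain.mono fun r₂ h => h.mono fun r₁ h r₃ hr₃ => ⟨(h r₃ hr₃).1, (h r₃ hr₃).2.1⟩,
    -- The minimum principle for `m` is a maximum principle for `-m`; negation exchanges the two
    -- limit alternatives.
    MonotoneNear.of_neg (monotoneNear_of_le_max hρ (hmain.mono fun r₂ h => h.mono
      fun r₁ h r₃ hr₃ => ?_) ?_)⟩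
  · rw [max_neg_neg]
    exact neg_le_neg ((h r₃ hr₃).2.2.trans (h r₃ hr₃).2.1)
  · simp only [neg_lt_neg_iff]
    exact (hm.eventually_lt hmpos').symm

end Main

end ThreeSpheres

theorem theorem5p1 (d : ℕ) (hd : 1 < d) (p : ℝ) (hp : 1 < p) (ζ : SingularPoint)
    (R : ℝ) (hR : 0 < R) (V : E d → ℝ) (hV : LocBounded V (puncturedNhd d ζ R))
    (g : ℝ → ℝ) (hg : SatisfiesC1 d p ζ V g)
    (ρ : ℝ) (hρ : 0 < ρ) (hρR : puncturedNhd d ζ ρ ⊆ puncturedNhd d ζ R)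
    (u : E d → ℝ) (hu : ∀ x ∈ puncturedNhd d ζ ρ, 0 < u x) :
    (IsSubsolution p V (puncturedNhd d ζ ρ) u → SubLimit d p u ζ →
      ForSpheresNear ρ (fun r₁ r₂ r₃ =>
        wolff d p ζ g r₁ < wolff d p ζ g r₂ ∧
        sphereSup u r₃ ≤ interp (sphereSup u) (wolff d p ζ g) r₁ r₂ r₃) ζ ∧
      MonotoneNear ρ (sphereSup u) ζ) ∧
    (IsSupersolution p V (puncturedNhd d ζ ρ) u → SuperLimit d p u ζ →
      ForSpheresNear ρ (fun r₁ r₂ r₃ =>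
        wolff d p ζ g r₁ < wolff d p ζ g r₂ ∧
        interp (sphereInf u) (wolff d p ζ g) r₁ r₂ r₃ ≤ sphereInf u r₃) ζ ∧
      MonotoneNear ρ (sphereInf u) ζ) := by
  have hd0 : 0 < d := zero_lt_one.trans hd
  have hVρ : LocBounded V (puncturedNhd d ζ ρ) := fun K hK h => hV K hK (h.trans hρR)
  refine ⟨fun hsub hlim => ?_, fun hsuper hlim => ?_⟩
  · obtain ⟨h1, h2⟩ := hsub.eventually_le_interp hd0 hp hg hρ hVρ hu hlim
    exact ⟨forSpheresNear_of_eventually hρ h1, h2⟩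
  · obtain ⟨h1, h2⟩ := hsuper.eventually_interp_le hd0 hp hg hρ hVρ hu hlim
    exact ⟨forSpheresNear_of_eventually hρ h1, h2⟩
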